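/- **Setting.** Consider $M$ interconnected linear subsystems $\dot x_i=A_{ii}x_i+B_iu_i+E_id_i+\sum_{j\in\mathcal N_i}A_{ij}x_j$ with $x_i\in\mathbb R^{n_i}$, regulated output $C_ix_i\in\mathbb R^{q_i}$ and neighbours $\mathcal N_i=\{j\ne i: A_{ij}\neq 0\}$, $N_i=|\mathcal N_i|$. Add integral states $\dot\xi_i=r_i-C_ix_i$, and put $\bar x_i=(x_i,\xi_i)\in\mathbb R^{n_i+q_i}$, $$\bar A_{ii}=\begin{pmatrix}A_{ii}&0\\-C_i&0\end{pmatrix},\quad \hat A_{ij}=\begin{pmatrix}A_{ij}&0\\0&0\end{pmatrix}\ (j\ne i),\quad \bar B_i=\begin{pmatrix}B_i\\0\end{pmatrix},\quad w_i(t)=\begin{pmatrix}0\\ r_i(t)\end{pmatrix}$$ (the disturbance $d_i$, compensated by the baseline controller, is excluded from the model). Let $\hat A_{m,i}$ be Hurwitz matrices (the desired local dynamics), and let $\hat{\mathbf A}$ be the block matrix with diagonal blocks $\hat A_{m,i}$ and off-diagonal blocks $\hat A_{ij}$. The plant is controlled by $u_i=-K_i\bar x_i-\hat\theta_i^T\bar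 x_i$: $$\dot{\bar x}_i=\bar A_{ii}\bar x_i+\bar B_iu_i+w_i+\sum_{j\in\mathcal N_i}\hat A_{ij}\bar x_j .$$ The predictor, which includes the neighbour interconnection terms, and the update law are, with $\tilde x_i=\bar x_i-\hat x_i$ and $u_i^{mrac}=-\hat\theta_i^T\bar x_i$, $$\dot{\hat x}_i=\hat A_{m,i}\hat x_i+\bar B_i(u_i^{mrac}+\hat\theta_i^T\bar x_i)+w_i+\sum_{j\in\mathcal N_i}\hat A_{ij}\hat x_j,\qquad \dot{\hat\theta}_i=\Gamma_i\,\mathrm{Proj}_i\big(\hat\theta_i,\ \bar x_i\tilde x_i^TP_i\bar B_i\big),$$ where $\Gamma_i>0$. Here $\mathrm{Proj}_i(\theta,y)=y-g_i(\theta)\frac{\langle\nabla g_i(\theta),y\rangle}{\|\nabla g_i(\theta)\|^2}\nabla g_i(\theta)$ if $g_i(\theta)\ge0$ and $\langle\nabla g_i(\theta),y\rangle>0$, and $\mathrm{Proj}_i(\theta,y)=y$ otherwise, with $g_i(\theta)=\frac{(\epsilon_{0,i}+1)\|\theta\|^2-\theta_{\max,i}^2}{\epsilon_{0,i}\theta_{\max,i}^2}$,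 $\epsilon_{0,i},\theta_{\max,i}>0$, and the Frobenius inner product and norm. **Proposition 2.** Let $\Xi_i$ be such that $\sum_{j\in\mathcal N_i}\lambda_{\max}(\hat A_{ij}^T\hat A_{ij})\le\Xi_i^2$ for all $i$, and suppose that for all $i$ $$\gamma_i:=\min_{\omega\ge0}\sigma_{\min}(\hat A_{m,i}-j\omega I)>\sqrt{N_i\,\Xi_i^2}.$$ Then there are symmetric positive-definite matrices $P_i$ and numbers $\varepsilon_i>0$ that solve the local algebraic Riccati equations $$\hat A_{m,i}^TP_i+P_i\hat A_{m,i}+N_iP_i^2+(\Xi_i^2+\varepsilon_i)I=0,$$ and the interconnected closed loop is globally asymptotically stable in the following sense. 1. The closed-loop model $\dot{\mathbf x}=\hat{\mathbf A}\mathbf x+\mathbf w$ is globally asymptotically stable: for every input $\mathbf w$, every solution on $[0,\infty)$ is Lyapunov stable (uniformly in the input and the solution) and attracts all other solutions with the same input. 2. Let $K_i,\Gamma_i,\theta_{\max,i},\epsilon_{0,i}$ be any design parameters as above, and let $\bar\theta_i$ be constant (unknown) parameters with $\bar A_{ii}-\bar B_iK_i-\hat A_{m,i}=\bar B_i\bar\theta_i^T$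 and $g_i(\bar\theta_i)\le0$. Then for the adaptive closed loop with these $P_i$: (a) the equilibrium $(\tilde x_i,\bar\theta_i-\hat\theta_i)_i=0$ of the error dynamics is Lyapunov stable, uniformly in the exogenous signals; (b) if the references $r_i$ are bounded, then for all initial conditions $\bar x_i,\hat x_i,\hat\theta_i$ are bounded on every interval $[0,T)$, $T\le\infty$, on which the solution exists; (c) if the references are bounded, then every solution on $[0,\infty)$ satisfies $\tilde x_i(t)\to0$ as $t\to\infty$ for all $i$; and (d) in that case also $\bar x_i(t)-x^*_i(t)\to0$ for every solution $\mathbf x^*$ of $\dot{\mathbf x}^*=\hat{\mathbf A}\mathbf x^*+(w_1,\dots,w_M)$; in particular $\bar x_i\to0$ if $r\equiv0$. -/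

import Mathlib

open Matrix Filter Topology

noncomputable section

namespace RobustMRAC

/-! ### Matrix quantities -/

/-- Smallest singular value of a square complex matrix: the least of the square roots of the
eigenvalues of `Aᴴ A`. -/
def sigmaMin {ι : Type*} [Fintype ι] [DecidableEq ι] (A : Matrix ι ι ℂ) : ℝ :=
  ⨅ k, Real.sqrt ((isHermitian_conjTranspose_mul_self A).eigenvalues k)

/-- Largest eigenvalue of `Aᵀ A` for a real matrix `A`
(over the reals the conjugate transpose is the transpose). -/
def lambdaMaxGram {κ ι : Type*} [Fintype κ] [Fintype ι] [DecidableEq ι]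
    (A : Matrix κ ι ℝ) : ℝ :=
  ⨆ k, (isHermitian_conjTranspose_mul_self A).eigenvalues k

/-- A real matrix is Hurwitz if all its complex eigenvalues have negative real part. -/
def IsHurwitz {ι : Type*} [Fintype ι] [DecidableEq ι] (A : Matrix ι ι ℝ) : Prop :=
  ∀ μ ∈ spectrum ℂ (A.map (algebraMap ℝ ℂ)), μ.re < 0

/-- `γ(A) = min_{ω ≥ 0} σ_min (A - jω I)`. -/
def gammaDist {ι : Type*} [Fintype ι] [DecidableEq ι] (A : Matrix ι ι ℝ) : ℝ :=
  ⨅ ω : Set.Ici (0 : ℝ),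
    sigmaMin (A.map (algebraMap ℝ ℂ) - (Complex.I * ((ω : ℝ) : ℂ)) • (1 : Matrix ι ι ℂ))

/-! ### The interconnected plant, augmented with integral states -/

/-- Index type of the augmented state `(x, ξ)` of subsystem `i`. -/
abbrev St {M : ℕ} (n q : Fin M → ℕ) (i : Fin M) : Type := Fin (n i) ⊕ Fin (q i)

/-- The data of a large-scale linear system with `M` input-decoupled subsystems
`x_i' = A_ii x_i + B_i u_i + E_i d_i + ∑_{j ∈ N_i} A_ij x_j`, with regulated output `C_i x_i`. -/
structure LSS (M : ℕ) (n m q r : Fin M → ℕ) where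
  /-- the blocks `A_ij` -/
  A : ∀ i j, Matrix (Fin (n i)) (Fin (n j)) ℝ
  /-- input matrices -/
  B : ∀ i, Matrix (Fin (n i)) (Fin (m i)) ℝ
  /-- output matrices -/
  C : ∀ i, Matrix (Fin (q i)) (Fin (n i)) ℝ
  /-- disturbance matrices -/
  E : ∀ i, Matrix (Fin (n i)) (Fin (r i)) ℝ

namespace LSS

variable {M : ℕ} {n m q r : Fin M → ℕ} (S : LSS M n m q r)

open Classical in
/-- The neighbours of subsystem `i`: all `j ≠ i` with `A_ij ≠ 0`. -/
def nbr (i : Fin M) : Finset (Fin M) :=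
  Finset.univ.filter fun j => j ≠ i ∧ S.A i j ≠ 0

/-- The augmented state matrix; the integral states satisfy `ξ_i' = r_i - C_i x_i`. -/
def Abar (i : Fin M) : Matrix (St n q i) (St n q i) ℝ :=
  fromBlocks (S.A i i) 0 (-S.C i) 0

/-- The augmented interconnection matrices. -/
def Aint (i j : Fin M) : Matrix (St n q i) (St n q j) ℝ :=
  fromBlocks (S.A i j) 0 0 0

/-- The augmented input matrix. -/
def Bbar (i : Fin M) : Matrix (St n q i) (Fin (m i)) ℝ :=
  fromRows (S.B i) 0

/-- The augmented exogenous input matrix, acting on `(d_i, r_i)`. -/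
def Ebar (i : Fin M) : Matrix (St n q i) (Fin (r i) ⊕ Fin (q i)) ℝ :=
  fromBlocks (S.E i) 0 0 1

/-- The matrix `F`, which removes the disturbance that the baseline controller compensates. -/
def Fmat (_S : LSS M n m q r) (i : Fin M) : Matrix (St n q i) (St n q i) ℝ :=
  fromBlocks 0 0 0 1

/-- The exogenous term `F Ē_i (d_i, r_i)`. -/
def exo (i : Fin M) (d : Fin (r i) → ℝ) (ref : Fin (q i) → ℝ) : St n q i → ℝ :=
  S.Fmat i *ᵥ (S.Ebar i *ᵥ Sum.elim d ref)

/-- The overall closed-loop matrix: `diag(Â_m1, …, Â_mM)` plus the off-diagonal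
interconnection blocks. -/
def Acl (Am : ∀ i, Matrix (St n q i) (St n q i) ℝ) :
    Matrix (Σ i, St n q i) (Σ i, St n q i) ℝ :=
  blockDiagonal' Am +
    Matrix.of fun a b => if a.1 = b.1 then 0 else S.Aint a.1 b.1 a.2 b.2

end LSS

/-! ### Global asymptotic stability of a linear time-invariant system with inputs -/

/-- `x` solves `x' = A x + w` on `[0, ∞)`. -/
def IsLinSol {ι : Type*} [Fintype ι] (A : Matrix ι ι ℝ) (w x : ℝ → ι → ℝ) : Prop :=
  ∀ t ∈ Set.Ici (0 : ℝ), HasDerivWithinAt x (A *ᵥ x t + w t) (Set.Ici 0) t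

/-- Global asymptotic stability of `x' = A x + w`: whatever the input `w`, each solution `y`
(for `w = 0`, e.g. the equilibrium `y = 0`) is Lyapunov stable, uniformly in `w` and `y`, and
attracts all other solutions for the same input. -/
structure IsGAS {ι : Type*} [Fintype ι] (A : Matrix ι ι ℝ) : Prop where
  stable : ∀ ε > 0, ∃ δ > 0, ∀ w x y : ℝ → ι → ℝ, IsLinSol A w x → IsLinSol A w y →
    ‖x 0 - y 0‖ < δ → ∀ t ≥ 0, ‖x t - y t‖ < ε
  attractive : ∀ w x y : ℝ → ι → ℝ, IsLinSol A w x → IsLinSol A w y →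
    Tendsto (fun t => x t - y t) atTop (𝓝 0)

/-! ### The projection operator -/

/-- The Frobenius inner product `tr (θᵀ η)`; for one column this is `θᵀ η`. -/
def frob {κ ι : Type*} [Fintype κ] [Fintype ι] (θ η : Matrix κ ι ℝ) : ℝ :=
  (θᵀ * η).trace

/-- The convex function `g(θ) = ((ε₀ + 1) θᵀθ - θ_max²) / (ε₀ θ_max²)`. -/
def projG {κ ι : Type*} [Fintype κ] [Fintype ι] (θmax ε₀ : ℝ) (θ : Matrix κ ι ℝ) : ℝ :=
  ((ε₀ + 1) * frob θ θ - θmax ^ 2) / (ε₀ * θmax ^ 2)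

/-- The gradient of `g`. -/
def projGrad {κ ι : Type*} (θmax ε₀ : ℝ) (θ : Matrix κ ι ℝ) : Matrix κ ι ℝ :=
  (2 * (ε₀ + 1) / (ε₀ * θmax ^ 2)) • θ

open Classical in
/-- The projection operator: `y` is left unchanged unless `g(θ) ≥ 0` and `∇g · y > 0`, in which
case `g(θ)` times the component of `y` along `∇g / ‖∇g‖` is subtracted. -/
def proj {κ ι : Type*} [Fintype κ] [Fintype ι] (θmax ε₀ : ℝ) (θ y : Matrix κ ι ℝ) :
    Matrix κ ι ℝ :=
  if 0 ≤ projG θmax ε₀ θ ∧ 0 < frob (projGrad θmax ε₀ θ) y then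
    y - (projG θmax ε₀ θ * frob (projGrad θmax ε₀ θ) y /
      frob (projGrad θmax ε₀ θ) (projGrad θmax ε₀ θ)) • projGrad θmax ε₀ θ
  else y

/-! ### The adaptive closed loop -/

/-- Design parameters of the local controllers: baseline state-feedback gains, adaptive gains,
bounds `θ_max` and tolerances `ε₀` of the projection. -/
structure Design {M : ℕ} (n m q : Fin M → ℕ) where
  K : ∀ i, Matrix (Fin (m i)) (St n q i) ℝ
  Γ : Fin M → ℝ
  θmax : Fin M → ℝ
  ε₀ : Fin M → ℝ
  Γ_pos : ∀ i, 0 < Γ i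
  θmax_pos : ∀ i, 0 < θmax i
  ε₀_pos : ∀ i, 0 < ε₀ i

/-- The signals of the adaptive closed loop: augmented plant states, predictor states and
parameter estimates. -/
structure Traj {M : ℕ} (n m q : Fin M → ℕ) where
  xbar : ∀ i, ℝ → St n q i → ℝ
  xhat : ∀ i, ℝ → St n q i → ℝ
  θhat : ∀ i, ℝ → Matrix (St n q i) (Fin (m i)) ℝ

namespace Traj

variable {M : ℕ} {n m q : Fin M → ℕ} (X : Traj n m q)

/-- The prediction error. -/
def xtil (i : Fin M) (t : ℝ) : St n q i → ℝ := X.xbar i t - X.xhat i t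

/-- The adaptive control signal `u = -θ̂ᵀ x̄`. -/
def umrac (i : Fin M) (t : ℝ) : Fin (m i) → ℝ := -((X.θhat i t)ᵀ *ᵥ X.xbar i t)

/-- The baseline control signal `u = -K x̄`. -/
def ubl (D : Design n m q) (i : Fin M) (t : ℝ) : Fin (m i) → ℝ := -(D.K i *ᵥ X.xbar i t)

end Traj

/-- The time interval `[0, T)`, where `T = ⊤` is allowed. -/
def timeIv (T : EReal) : Set ℝ := {t | 0 ≤ t ∧ (t : EReal) < T}

/-- `X` solves, on `[0, T)`, the equations of the plant under baseline and adaptive control, of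
the predictors with neighbour interconnection terms, and of the projection-based update law. -/
structure IsClosedLoopSol {M : ℕ} {n m q r : Fin M → ℕ} (S : LSS M n m q r)
    (Am P : ∀ i, Matrix (St n q i) (St n q i) ℝ) (D : Design n m q)
    (d : ∀ i, ℝ → Fin (r i) → ℝ) (ref : ∀ i, ℝ → Fin (q i) → ℝ)
    (T : EReal) (X : Traj n m q) : Prop where
  plant : ∀ i, ∀ t ∈ timeIv T, HasDerivWithinAt (X.xbar i)
    (S.Abar i *ᵥ X.xbar i t + S.Bbar i *ᵥ (X.ubl D i t + X.umrac i t)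
      + S.exo i (d i t) (ref i t) + ∑ j ∈ S.nbr i, S.Aint i j *ᵥ X.xbar j t) (timeIv T) t
  predictor : ∀ i, ∀ t ∈ timeIv T, HasDerivWithinAt (X.xhat i)
    (Am i *ᵥ X.xhat i t + S.Bbar i *ᵥ (X.umrac i t + (X.θhat i t)ᵀ *ᵥ X.xbar i t)
      + S.exo i (d i t) (ref i t) + ∑ j ∈ S.nbr i, S.Aint i j *ᵥ X.xhat j t) (timeIv T) t
  update : ∀ i, ∀ t ∈ timeIv T, ∀ a b, HasDerivWithinAt (fun s => X.θhat i s a b)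
    (D.Γ i * proj (D.θmax i) (D.ε₀ i) (X.θhat i t)
      (vecMulVec (X.xbar i t) (X.xtil i t ᵥ* P i ᵥ* S.Bbar i)) a b) (timeIv T) t

/-- Global asymptotic stability of the adaptive closed loop, whose true (unknown) parameters are
`θ`: the error equilibrium `(x̃, θ̃) = (0, 0)` is Lyapunov stable, uniformly in the exogenous
signals; under bounded references all signals are bounded, for all initial conditions (and on
each interval of existence, so that nothing escapes in finite time); the prediction errors tend
to zero, for all initial conditions; and the plant converges to the closed-loop model
`x' = Â x + F Ē (d, r)`. -/
structure IsAdaptiveGAS {M : ℕ} {n m q r : Fin M → ℕ} (S : LSS M n m q r)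
    (Am P : ∀ i, Matrix (St n q i) (St n q i) ℝ) (D : Design n m q)
    (θ : ∀ i, Matrix (St n q i) (Fin (m i)) ℝ) : Prop where
  stable : ∀ ε > 0, ∃ δ > 0, ∀ d ref T X, IsClosedLoopSol S Am P D d ref T X →
    (∀ i, ‖X.xtil i 0‖ < δ ∧ ∀ a b, |θ i a b - X.θhat i 0 a b| < δ) →
    ∀ t ∈ timeIv T, ∀ i, ‖X.xtil i t‖ < ε ∧ ∀ a b, |θ i a b - X.θhat i t a b| < ε
  bounded : ∀ d ref T X, IsClosedLoopSol S Am P D d ref T X →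
    (∃ R, ∀ i, ∀ t ∈ timeIv T, ‖ref i t‖ ≤ R) →
    ∃ R, ∀ i, ∀ t ∈ timeIv T, ‖X.xbar i t‖ ≤ R ∧ ‖X.xhat i t‖ ≤ R ∧
      ∀ a b, |X.θhat i t a b| ≤ R
  convergent : ∀ d ref X, IsClosedLoopSol S Am P D d ref ⊤ X →
    (∃ R, ∀ i, ∀ t ≥ 0, ‖ref i t‖ ≤ R) →
    ∀ i, Tendsto (X.xtil i) atTop (𝓝 0)
  tracks : ∀ d ref X, IsClosedLoopSol S Am P D d ref ⊤ X →
    (∃ R, ∀ i, ∀ t ≥ 0, ‖ref i t‖ ≤ R) →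
    ∀ x : ℝ → (Σ i, St n q i) → ℝ,
      IsLinSol (S.Acl Am) (fun t a => S.exo a.1 (d a.1 t) (ref a.1 t) a.2) x →
      ∀ i, Tendsto (fun t => X.xbar i t - fun a => x t ⟨i, a⟩) atTop (𝓝 0)

end RobustMRAC

end

noncomputable section

namespace RobustMRAC

/-! ### Hurwitz matrices: openness, continuation along paths, Lyapunov and Sylvester arguments. -/

section LinearAlgebra

variable {ι : Type*} [Fintype ι] [DecidableEq ι]

/-! Stability of the interconnection. Each subsystem gets the storage function x_iᵀ P_i x_i. Young's
inequality splits the coupling 2 x_iᵀ P_i Â_ij x_j into |P_i x_i|² and λ_max(Â_ijᵀ Â_ij) |x_j|². The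
N_i copies of the former are absorbed by the term N_i P_i² of the Riccati equation, which leaves
-(Ξ_i² + ε_i)|x_i|² against the neighbour terms. The hypothesis on Ξ controls row sums of the
coupling, whereas adding storage functions produces column sums. Positive weights c_i from M-matrix
theory (`exists_pos_weights`) bridge the two, and `exists_weights_dissipation` yields strict
dissipation for diag(c_i P_i).

Existence of P_i (`exists_posDef_riccati`) is a strict bounded real lemma, proved by continuation:
in AᵀQ + QA + Q² + sI = 0 the parameter s grows from 0, where Q = 0, keeping A + Q Hurwitz. The
solvable s form an open set by the inverse function theorem, the derivative being an injective
Sylvester operator. They form a closed set because solutions are bounded a priori and an eigenvalue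
jω of A + Q would make s an eigenvalue of (A - jωI)ᴴ(A - jωI), which the gap condition on γ
excludes.

Adaptive loop. Adding the parameter errors with weights c_i/Γ_i cancels the unknown cross term, and
the projection only helps, so the energy does not increase. The adaptive input cancels inside the
predictor, which is therefore the closed-loop model itself and stays bounded under bounded
references. Hence x̃ has bounded derivative, and Barbalat's argument gives x̃ → 0. -/

theorem mem_spectrum_iff_exists_mulVec {M : Matrix ι ι ℂ} {μ : ℂ} :
    μ ∈ spectrum ℂ M ↔ ∃ v : ι → ℂ, v ≠ 0 ∧ M *ᵥ v = μ • v := by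
  rw [mem_spectrum_iff_isRoot_charpoly, Polynomial.IsRoot, eval_charpoly,
    ← exists_mulVec_eq_zero_iff]
  refine exists_congr fun v => and_congr_right fun _ => ?_
  rw [sub_mulVec, scalar_apply, ← smul_one_eq_diagonal, smul_mulVec, one_mulVec,
    sub_eq_zero, eq_comm]

theorem mem_spectrum_iff_det {M : Matrix ι ι ℂ} {μ : ℂ} :
    μ ∈ spectrum ℂ M ↔ (scalar ι μ - M).det = 0 := by
  rw [mem_spectrum_iff_isRoot_charpoly, Polynomial.IsRoot, eval_charpoly]

theorem conj_mem_spectrum {A : Matrix ι ι ℝ} {μ : ℂ}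
    (h : μ ∈ spectrum ℂ (A.map (algebraMap ℝ ℂ))) :
    star μ ∈ spectrum ℂ (A.map (algebraMap ℝ ℂ)) := by
  rw [mem_spectrum_iff_exists_mulVec] at h ⊢
  obtain ⟨v, hv, h⟩ := h
  refine ⟨star v, by simpa using hv, ?_⟩
  have := congrArg star h
  rw [star_mulVec, ← mulVec_transpose] at this
  rw [star_smul] at this
  rw [← this]
  congr 1
  ext i j
  simp

theorem exists_real_pair {A : Matrix ι ι ℝ} {μ : ℂ}
    (h : μ ∈ spectrum ℂ (A.map (algebraMap ℝ ℂ))) :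
    ∃ x y : ι → ℝ, (x ≠ 0 ∨ y ≠ 0) ∧ A *ᵥ x = μ.re • x - μ.im • y ∧
      A *ᵥ y = μ.im • x + μ.re • y := by
  obtain ⟨v, hv, h⟩ := mem_spectrum_iff_exists_mulVec.1 h
  refine ⟨fun i => (v i).re, fun i => (v i).im, ?_, ?_, ?_⟩
  · by_contra! hc
    exact hv (funext fun i => Complex.ext (congrFun hc.1 i) (congrFun hc.2 i))
  · ext i
    have := congrArg Complex.re (congrFun h i)
    simpa [mulVec, dotProduct] using this
  · ext i
    have := congrArg Complex.im (congrFun h i)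
    simp [mulVec, dotProduct] at this ⊢
    linarith

theorem mem_spectrum_of_real {A : Matrix ι ι ℝ} {a : ℝ} {v : ι → ℝ} (hv : v ≠ 0)
    (h : A *ᵥ v = a • v) : (a : ℂ) ∈ spectrum ℂ (A.map (algebraMap ℝ ℂ)) := by
  refine mem_spectrum_iff_exists_mulVec.2 ⟨fun i => (v i : ℂ), ?_, ?_⟩
  · intro hc
    exact hv (funext fun i => by simpa using congrFun hc i)
  · ext i
    have := congrArg (fun r : ℝ => (r : ℂ)) (congrFun h i)
    simpa [mulVec, dotProduct] using this

theorem norm_le_of_mem_spectrum {A : Matrix ι ι ℝ} {μ : ℂ}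
    (h : μ ∈ spectrum ℂ (A.map (algebraMap ℝ ℂ))) : ‖μ‖ ≤ ∑ i, ∑ j, |A i j| := by
  obtain ⟨v, hv, h⟩ := mem_spectrum_iff_exists_mulVec.1 h
  have hv' : 0 < ‖v‖ := norm_pos_iff.2 hv
  refine le_of_mul_le_mul_right ?_ hv'
  rw [← norm_smul, ← h]
  have hS : 0 ≤ ∑ i, ∑ j, |A i j| := by positivity
  refine (pi_norm_le_iff_of_nonneg (by positivity)).2 fun i => ?_
  calc ‖(A.map (algebraMap ℝ ℂ) *ᵥ v) i‖ ≤ ∑ j, |A i j| * ‖v‖ := by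
        refine (norm_sum_le _ _).trans (Finset.sum_le_sum fun j _ => ?_)
        rw [norm_mul]
        refine mul_le_mul (by simp) (norm_le_pi_norm v j) (norm_nonneg _) (abs_nonneg _)
    _ = (∑ j, |A i j|) * ‖v‖ := by rw [Finset.sum_mul]
    _ ≤ _ := by
        refine mul_le_mul_of_nonneg_right ?_ hv'.le
        exact Finset.single_le_sum (f := fun k => ∑ j, |A k j|)
          (fun k _ => Finset.sum_nonneg fun j _ => abs_nonneg (A k j)) (Finset.mem_univ i)

theorem continuous_det_scalar_sub :
    Continuous fun p : Matrix ι ι ℝ × ℂ =>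
      (scalar ι p.2 - p.1.map (algebraMap ℝ ℂ)).det := by
  refine Continuous.matrix_det (Continuous.sub ?_ ?_)
  · simp only [scalar_apply]
    exact Continuous.matrix_diagonal (continuous_pi fun _ => continuous_snd)
  · exact continuous_fst.matrix_map (by simpa using Complex.continuous_ofReal)

/-- Eigenvalues of matrices near A stay in a fixed disc, and on its compact right half nonvanishing
of det(μ - A) persists under perturbation. -/
theorem isOpen_isHurwitz : IsOpen {A : Matrix ι ι ℝ | IsHurwitz A} := by
  rw [isOpen_iff_eventually]
  intro A hA
  set C : ℝ := ∑ i, ∑ j, |A i j| + 1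
  have hC : ∀ᶠ B : Matrix ι ι ℝ in 𝓝 A, ∑ i, ∑ j, |B i j| < C := by
    have : Continuous fun B : Matrix ι ι ℝ => ∑ i, ∑ j, |B i j| := by fun_prop
    exact this.continuousAt.eventually_lt_const (by simp [C])
  let K : Set ℂ := Metric.closedBall 0 C ∩ {μ | 0 ≤ μ.re}
  have hK : IsCompact K := (isCompact_closedBall _ _).inter_right
    (isClosed_le continuous_const Complex.continuous_re)
  have hdet : ∀ᶠ B : Matrix ι ι ℝ in 𝓝 A, ∀ μ ∈ K,
      (scalar ι μ - B.map (algebraMap ℝ ℂ)).det ≠ 0 := by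
    refine hK.eventually_forall_of_forall_eventually fun μ hμ => ?_
    refine continuous_det_scalar_sub.continuousAt.eventually_ne ?_
    intro h0
    exact (hA μ (mem_spectrum_iff_det.2 h0)).not_ge hμ.2
  filter_upwards [hC, hdet] with B h1 h2 μ hμ
  by_contra! hre
  refine h2 μ ⟨?_, hre⟩ (mem_spectrum_iff_det.1 hμ)
  simpa using ((norm_le_of_mem_spectrum hμ).trans h1.le)

/-- A closed condition that, for matrices without eigenvalues on the imaginary axis, is equivalent
to being Hurwitz. -/
def IsSemiHurwitz (A : Matrix ι ι ℝ) : Prop :=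
  ∀ μ : ℂ, 0 ≤ μ.re → μ.re ^ Fintype.card ι ≤ ‖(scalar ι μ - A.map (algebraMap ℝ ℂ)).det‖

/-- The determinant is the product of μ - z over the eigenvalues z, and re z < 0 gives |μ - z| ≥ re
μ for each factor. -/
theorem IsHurwitz.isSemiHurwitz {A : Matrix ι ι ℝ} (hA : IsHurwitz A) : IsSemiHurwitz A := by
  intro μ hμ
  set p := (A.map (algebraMap ℝ ℂ)).charpoly with hp
  have hs : p.Splits := IsAlgClosed.splits p
  have hcard : p.roots.card = Fintype.card ι := by
    rw [← hs.natDegree_eq_card_roots, charpoly_natDegree_eq_dim]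
  rw [← eval_charpoly, ← hp, hs.eq_prod_roots_of_monic (charpoly_monic _),
    Polynomial.eval_multiset_prod, ← hcard, Multiset.map_map]
  have hroot : ∀ z ∈ p.roots, μ.re ≤ ‖μ - z‖ := by
    intro z hz
    have := hA z (mem_spectrum_iff_isRoot_charpoly.2 (Polynomial.isRoot_of_mem_roots hz))
    have h2 := Complex.re_le_norm (μ - z)
    rw [Complex.sub_re] at h2
    linarith
  clear_value p
  clear hs hcard hp
  generalize p.roots = s at hroot
  induction s using Multiset.induction_on with
  | empty => simp
  | cons a s ih =>
    simp only [Multiset.card_cons, Multiset.map_cons, Multiset.prod_cons, norm_mul, pow_succ']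
    refine mul_le_mul ?_ (ih fun z hz => hroot z (Multiset.mem_cons_of_mem hz))
      (pow_nonneg hμ _) (norm_nonneg _)
    simpa using hroot a (Multiset.mem_cons_self a s)

theorem isClosed_isSemiHurwitz : IsClosed {A : Matrix ι ι ℝ | IsSemiHurwitz A} := by
  simp only [IsSemiHurwitz, Set.ofPred_forall]
  refine isClosed_iInter fun μ => isClosed_iInter fun _ => isClosed_le continuous_const ?_
  exact (continuous_det_scalar_sub.comp (continuous_id.prodMk continuous_const)).norm

theorem IsSemiHurwitz.isHurwitz {A : Matrix ι ι ℝ} (hA : IsSemiHurwitz A)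
    (h : ∀ μ ∈ spectrum ℂ (A.map (algebraMap ℝ ℂ)), μ.re ≠ 0) : IsHurwitz A := by
  intro μ hμ
  by_contra! hre
  have h0 := mem_spectrum_iff_det.1 hμ
  have hlt := lt_of_le_of_ne hre (h μ hμ).symm
  have := hA μ hre
  rw [h0, norm_zero] at this
  exact (pow_pos hlt _).not_ge this

/-- Connectedness of [0, 1]: the Hurwitz parameters are open, and closed because along the path
Hurwitz coincides with the closed condition `IsSemiHurwitz`. -/
theorem isHurwitz_of_path (γ : ℝ → Matrix ι ι ℝ) (hγ : Continuous γ)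
    (h : ∀ t ∈ Set.Icc (0 : ℝ) 1, ∀ μ ∈ spectrum ℂ ((γ t).map (algebraMap ℝ ℂ)), μ.re ≠ 0)
    (h0 : IsHurwitz (γ 0)) : IsHurwitz (γ 1) := by
  have key : Set.Icc (0 : ℝ) 1 ⊆ γ ⁻¹' {A | IsHurwitz A} := by
    refine IsClosed.Icc_subset_of_forall_mem_nhdsWithin ?_ h0 ?_
    · have : γ ⁻¹' {A | IsHurwitz A} ∩ Set.Icc 0 1 = γ ⁻¹' {A | IsSemiHurwitz A} ∩ Set.Icc 0 1 := by
        ext t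
        exact ⟨fun ht => ⟨IsHurwitz.isSemiHurwitz ht.1, ht.2⟩,
          fun ht => ⟨IsSemiHurwitz.isHurwitz ht.1 (h t ht.2), ht.2⟩⟩
      rw [this]
      exact (isClosed_isSemiHurwitz.preimage hγ).inter isClosed_Icc
    · intro t ht
      exact mem_nhdsWithin_of_mem_nhds ((isOpen_isHurwitz.preimage hγ).mem_nhds ht.1)
  exact key ⟨zero_le_one, le_rfl⟩

/-- If `Q A` has negative definite symmetric part, with `Q` symmetric, then `A` has no eigenvalues
on the imaginary axis. -/
theorem re_ne_zero_of_lyapunov {A Q : Matrix ι ι ℝ} (hQ : Qᵀ = Q)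
    (hneg : ∀ x : ι → ℝ, x ≠ 0 → x ⬝ᵥ (Q *ᵥ (A *ᵥ x)) < 0)
    {μ : ℂ} (hμ : μ ∈ spectrum ℂ (A.map (algebraMap ℝ ℂ))) : μ.re ≠ 0 := by
  intro hre
  obtain ⟨x, y, hxy, hx, hy⟩ := exists_real_pair hμ
  have hx' : x ⬝ᵥ (Q *ᵥ (A *ᵥ x)) ≤ 0 := by
    rcases eq_or_ne x 0 with rfl | h
    · simp
    · exact (hneg x h).le
  have hy' : y ⬝ᵥ (Q *ᵥ (A *ᵥ y)) ≤ 0 := by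
    rcases eq_or_ne y 0 with rfl | h
    · simp
    · exact (hneg y h).le
  have hsymm : y ⬝ᵥ (Q *ᵥ x) = x ⬝ᵥ (Q *ᵥ y) := by
    rw [dotProduct_mulVec, ← mulVec_transpose, hQ, dotProduct_comm]
  -- For a purely imaginary eigenvalue with eigenvector x + jy, the cross terms cancel by symmetry
  -- of Q.
  have hsum : x ⬝ᵥ (Q *ᵥ (A *ᵥ x)) + y ⬝ᵥ (Q *ᵥ (A *ᵥ y)) = 0 := by
    rw [hx, hy, hre]
    simp only [zero_smul, zero_sub, add_zero, mulVec_neg, mulVec_smul, dotProduct_neg,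
      dotProduct_smul, hsymm]
    ring
  rcases hxy with h | h
  · linarith [hneg x h]
  · linarith [hneg y h]

/-- A homotopy replaces the usual integral of matrix exponentials: the segment from A to -Q⁻¹ keeps
the form xᵀQ(·)x negative, so -Q⁻¹ is Hurwitz as well, which for symmetric Q means positive
eigenvalues. -/
theorem posDef_of_lyapunov {A Q : Matrix ι ι ℝ} (hA : IsHurwitz A) (hQ : Qᵀ = Q)
    (hneg : ∀ x : ι → ℝ, x ≠ 0 → x ⬝ᵥ (Q *ᵥ (A *ᵥ x)) < 0) : Q.PosDef := by
  have hsymm : ∀ x y, y ⬝ᵥ (Q *ᵥ x) = x ⬝ᵥ (Q *ᵥ y) := by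
    intro x y
    rw [dotProduct_mulVec, ← mulVec_transpose, hQ, dotProduct_comm]
  have hinj : ∀ x : ι → ℝ, Q *ᵥ x = 0 → x = 0 := by
    intro x hx
    by_contra h0
    have := hneg x h0
    rw [← hsymm, hx, dotProduct_zero] at this
    exact this.false
  have hdet : IsUnit Q.det := by
    rw [isUnit_iff_ne_zero]
    intro h0
    obtain ⟨v, hv, h⟩ := exists_mulVec_eq_zero_iff.2 h0
    exact hv (hinj v h)
  have hH : IsHurwitz (-Q⁻¹) := by
    have := isHurwitz_of_path (fun t => (1 - t) • A + t • (-Q⁻¹)) (by fun_prop) ?_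
      (by simpa using hA)
    · simpa using this
    intro t ht μ hμ
    refine re_ne_zero_of_lyapunov hQ (fun x hx => ?_) hμ
    have h1 : Q *ᵥ (Q⁻¹ *ᵥ x) = x := by
      rw [mulVec_mulVec, mul_nonsing_inv _ hdet, one_mulVec]
    have h2 : 0 < x ⬝ᵥ x := by
      have := dotProduct_star_self_pos_iff.2 hx
      simpa using this
    simp only [add_mulVec, smul_mulVec, neg_mulVec, mulVec_add, mulVec_smul, mulVec_neg, h1,
      dotProduct_add, dotProduct_smul, dotProduct_neg, smul_eq_mul]
    have h3 := hneg x hx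
    obtain ⟨ht0, ht1⟩ := ht
    rcases eq_or_lt_of_le ht0 with rfl | h4
    · simpa using h3
    · nlinarith [mul_nonneg (sub_nonneg.2 ht1) (neg_nonneg.2 h3.le), mul_pos h4 h2]
  have hherm : Q.IsHermitian := by
    rw [IsHermitian, conjTranspose_eq_transpose_of_trivial, hQ]
  rw [hherm.posDef_iff_eigenvalues_pos]
  intro i
  set v : ι → ℝ := (hherm.eigenvectorBasis i).ofLp with hv
  have hv0 : v ≠ 0 := by
    intro h
    have h1 := hherm.eigenvectorBasis.orthonormal.ne_zero i
    exact h1 (by ext k; exact congrFun h k)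
  have hev : Q *ᵥ v = hherm.eigenvalues i • v := by
    simpa using hherm.mulVec_eigenvectorBasis i
  have hne : hherm.eigenvalues i ≠ 0 := by
    intro h
    rw [h, zero_smul] at hev
    exact hv0 (hinj v hev)
  have hev' : (-Q⁻¹) *ᵥ v = (-(hherm.eigenvalues i)⁻¹) • v := by
    have h1 : v = (hherm.eigenvalues i)⁻¹ • (Q *ᵥ v) := by
      rw [hev, smul_smul, inv_mul_cancel₀ hne, one_smul]
    have h2 : Q⁻¹ *ᵥ (Q *ᵥ v) = v := by
      rw [mulVec_mulVec, nonsing_inv_mul _ hdet, one_mulVec]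
    calc (-Q⁻¹) *ᵥ v = -(Q⁻¹ *ᵥ ((hherm.eigenvalues i)⁻¹ • (Q *ᵥ v))) := by rw [← h1, neg_mulVec]
      _ = _ := by rw [mulVec_smul, h2, neg_smul]
  have := hH _ (mem_spectrum_of_real hv0 hev')
  rw [Complex.ofReal_re] at this
  exact inv_pos.1 (by linarith)

open Polynomial in
/-- The Sylvester operator `H ↦ Rᵀ H + H R` of a Hurwitz matrix is injective. -/
theorem sylvester_injective {R H : Matrix ι ι ℝ} (hR : IsHurwitz R) (h : Rᵀ * H + H * R = 0) :
    H = 0 := by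
  have hcomm : H * R = (-Rᵀ) * H := by rw [neg_mul]; exact eq_neg_of_add_eq_zero_right h
  have hpow : ∀ k : ℕ, H * R ^ k = (-Rᵀ) ^ k * H := by
    intro k
    induction k with
    | zero => simp
    | succ k ih => rw [pow_succ, ← mul_assoc, ih, mul_assoc, hcomm, ← mul_assoc, ← pow_succ]
  have hpoly : ∀ p : ℝ[X], H * aeval R p = aeval (-Rᵀ) p * H := by
    intro p
    induction p using Polynomial.induction_on' with
    | add p q hp hq => simp [mul_add, add_mul, hp, hq]
    | monomial k a =>
      simp only [aeval_monomial, ← Algebra.smul_def, mul_smul_comm, smul_mul_assoc, hpow]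
  -- Cayley–Hamilton kills the side with R, so it remains to see that the characteristic polynomial
  -- of R is invertible at -Rᵀ.
  have h0 : aeval (-Rᵀ) R.charpoly * H = 0 := by
    rw [← hpoly, aeval_self_charpoly, mul_zero]
  have hunit : IsUnit (aeval (-Rᵀ) R.charpoly) := by
    by_contra hnot
    have hnot' : ¬ IsUnit (aeval ((-Rᵀ).map (algebraMap ℝ ℂ))
        (R.map (algebraMap ℝ ℂ)).charpoly) := by
      have hmap : aeval ((-Rᵀ).map (algebraMap ℝ ℂ)) (R.map (algebraMap ℝ ℂ)).charpoly =
          (algebraMap ℝ ℂ).mapMatrix (aeval (-Rᵀ) R.charpoly) := by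
        rw [charpoly_map, aeval_def, aeval_def, eval₂_map, hom_eval₂]
        congr 1
        ext a i j
        simp only [RingHom.comp_apply, RingHom.mapMatrix_apply, map_apply, algebraMap_matrix_apply]
        split_ifs <;> simp
      rw [hmap, isUnit_iff_isUnit_det, ← RingHom.map_det, isUnit_iff_ne_zero, not_not,
        map_eq_zero]
      rwa [isUnit_iff_isUnit_det, isUnit_iff_ne_zero, not_not] at hnot
    rw [(IsAlgClosed.splits _).eq_prod_roots_of_monic (charpoly_monic _)] at hnot'
    -- A singular value of the polynomial would give k with both k and -k eigenvalues of R, though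
    -- both need negative real part.
    obtain ⟨k, hk, hk'⟩ := spectrum.exists_mem_of_not_isUnit_aeval_prod hnot'
    have h1 := hR k (mem_spectrum_iff_isRoot_charpoly.2 hk')
    have h2 : -k ∈ spectrum ℂ (R.map (algebraMap ℝ ℂ)) := by
      have hneg : (-Rᵀ).map (algebraMap ℝ ℂ) = -(R.map (algebraMap ℝ ℂ))ᵀ := by
        ext i j; simp
      rw [hneg, ← spectrum.neg_eq, Set.mem_neg, mem_spectrum_iff_isRoot_charpoly,
        charpoly_transpose, ← mem_spectrum_iff_isRoot_charpoly] at hk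
      exact hk
    have h3 := hR _ h2
    rw [Complex.neg_re] at h3
    linarith
  obtain ⟨u, hu⟩ := hunit
  rw [← hu] at h0
  simpa using congrArg (fun Z => (↑u⁻¹ : Matrix ι ι ℝ) * Z) h0

end LinearAlgebra

/-! ### The algebraic Riccati equation and the bounded real lemma. -/

section Riccati

variable {ι : Type*} [Fintype ι] [DecidableEq ι]

/-- √s is at least the smallest singular value of A - jωI, hence at least γ(A) > √k. -/
theorem lt_of_sqrt_lt_gammaDist {A : Matrix ι ι ℝ} {k : ℝ} (hk : √k < gammaDist A) {ω s : ℝ}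
    (hω : 0 ≤ ω) {v : ι → ℂ} (hv : v ≠ 0)
    (h : ((A.map (algebraMap ℝ ℂ) - (Complex.I * ω) • 1)ᴴ *
      (A.map (algebraMap ℝ ℂ) - (Complex.I * ω) • 1)) *ᵥ v = (s : ℂ) • v) : k < s := by
  set B := A.map (algebraMap ℝ ℂ) - (Complex.I * ω) • 1 with hB
  have hmem : (s : ℂ) ∈ spectrum ℂ (Bᴴ * B) := mem_spectrum_iff_exists_mulVec.2 ⟨v, hv, h⟩
  rw [(isHermitian_conjTranspose_mul_self B).spectrum_eq_image_range] at hmem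
  obtain ⟨_, ⟨i, rfl⟩, hi⟩ := hmem
  have hi' : (isHermitian_conjTranspose_mul_self B).eigenvalues i = s := by
    simpa using hi
  have hnn : ∀ C : Matrix ι ι ℂ, 0 ≤ sigmaMin C := fun C =>
    Real.iInf_nonneg fun _ => Real.sqrt_nonneg _
  have h1 : gammaDist A ≤ sigmaMin B :=
    ciInf_le (f := fun ω : Set.Ici (0 : ℝ) =>
      sigmaMin (A.map (algebraMap ℝ ℂ) - (Complex.I * ((ω : ℝ) : ℂ)) • (1 : Matrix ι ι ℂ)))
      ⟨0, by rintro _ ⟨ω, rfl⟩; exact hnn _⟩ ⟨ω, hω⟩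
  have h2 : sigmaMin B ≤ √s := by
    rw [← hi']
    exact ciInf_le (Set.finite_range _).bddBelow i
  by_contra! hc
  exact ((hk.trans_le h1).trans_le h2).not_ge (Real.sqrt_le_sqrt hc)

/-- A solution `Q` of `Aᵀ Q + Q A + Q² + s I = 0` makes `s` an
eigenvalue of `(A - jω)ᴴ (A - jω)` whenever `jω` is an eigenvalue of `A + Q`. -/
theorem re_ne_zero_of_riccati {A Q : Matrix ι ι ℝ} {k s : ℝ} (hk : √k < gammaDist A) (hs : s ≤ k)
    (hric : Aᵀ * Q + Q * A + Q * Q + s • (1 : Matrix ι ι ℝ) = 0) {μ : ℂ}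
    (hμ : μ ∈ spectrum ℂ ((A + Q).map (algebraMap ℝ ℂ))) : μ.re ≠ 0 := by
  -- `gammaDist` only ranges over ω ≥ 0; conjugation covers the lower half of the axis.
  wlog him : 0 ≤ μ.im generalizing μ
  · have := this (conj_mem_spectrum hμ) (by simpa using (not_le.1 him).le)
    simpa using this
  intro hre
  obtain ⟨v, hv, h⟩ := mem_spectrum_iff_exists_mulVec.1 hμ
  have hμ' : μ = Complex.I * (μ.im : ℝ) := by
    apply Complex.ext <;> simp [hre]
  set c := algebraMap ℝ ℂ
  have hricC : (A.map c)ᵀ * Q.map c + Q.map c * A.map c + Q.map c * Q.map c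
      + (s : ℂ) • (1 : Matrix ι ι ℂ) = 0 := by
    have := congrArg c.mapMatrix hric
    simp only [map_add, map_mul, map_zero, RingHom.mapMatrix_apply] at this
    rw [← this, transpose_map]
    congr 1
    ext i j
    simp [one_apply]
    split_ifs <;> simp [c]
  rw [Matrix.map_add c (map_add c), add_mulVec] at h
  -- From (A + Q)v = μv one gets (A - μ)v = -Qv. Since (A - μ)ᴴ = Aᵀ + μ for imaginary μ, the
  -- Riccati equation turns -(Aᵀ + μ)Qv into sv.
  refine (lt_of_sqrt_lt_gammaDist hk him hv (s := s) ?_).not_ge hs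
  rw [← hμ', ← mulVec_mulVec, sub_mulVec, smul_mulVec, one_mulVec, ← h]
  have e1 : A.map c *ᵥ v - (A.map c *ᵥ v + Q.map c *ᵥ v) = -(Q.map c *ᵥ v) := by abel
  have e2 : (A.map c - μ • 1)ᴴ = (A.map c)ᵀ + μ • 1 := by
    rw [conjTranspose_sub, conjTranspose_smul, conjTranspose_one]
    have : star μ = -μ := by
      apply Complex.ext <;> simp [hre]
    rw [this, neg_smul, sub_neg_eq_add]
    congr 1
    ext i j
    simp [c]
  have e3 := congrArg (· *ᵥ v) hricC
  simp only [add_mulVec, zero_mulVec, smul_mulVec, one_mulVec, ← mulVec_mulVec] at e3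
  rw [e1, e2, mulVec_neg, add_mulVec, smul_mulVec, one_mulVec, ← mulVec_smul, ← h, mulVec_add]
  rw [← add_assoc, neg_eq_iff_add_eq_zero]
  exact e3

section InverseFunction

attribute [local instance] Matrix.normedAddCommGroup Matrix.normedSpace

/-- The Riccati equation can be solved near a stabilizing solution. -/
theorem eventually_exists_riccati {A Q : Matrix ι ι ℝ} {s : ℝ}
    (hQ : Qᵀ = Q) (hric : Aᵀ * Q + Q * A + Q * Q + s • (1 : Matrix ι ι ℝ) = 0)
    (hR : IsHurwitz (A + Q)) :
    ∀ᶠ t in 𝓝 s, ∃ X : Matrix ι ι ℝ, Xᵀ = X ∧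
      Aᵀ * X + X * A + X * X + t • (1 : Matrix ι ι ℝ) = 0 ∧ IsHurwitz (A + X) := by
  let f : Matrix ι ι ℝ → Matrix ι ι ℝ := fun X => Aᵀ * X + X * A + X * X
  -- The derivative of `f` at Q; it is invertible because A + Q is Hurwitz.
  let L : Matrix ι ι ℝ →ₗ[ℝ] Matrix ι ι ℝ :=
    LinearMap.mulLeft ℝ (A + Q)ᵀ + LinearMap.mulRight ℝ (A + Q)
  have hL : Function.Injective L := by
    rw [← LinearMap.ker_eq_bot, LinearMap.ker_eq_bot']
    intro H hH
    exact sylvester_injective hR hH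
  let e := (LinearEquiv.ofInjectiveEndo L hL).toContinuousLinearEquiv
  have he : ∀ H, e H = (A + Q)ᵀ * H + H * (A + Q) := fun H => rfl
  have hf : HasStrictFDerivAt f (e : Matrix ι ι ℝ →L[ℝ] Matrix ι ι ℝ) Q := by
    have h1 := (LinearMap.toContinuousLinearMap (LinearMap.mulLeft ℝ Aᵀ)).hasStrictFDerivAt (x := Q)
    have h2 := (LinearMap.toContinuousLinearMap (LinearMap.mulRight ℝ A)).hasStrictFDerivAt (x := Q)
    have h3 := (LinearMap.toContinuousBilinearMap
      (LinearMap.mul ℝ (Matrix ι ι ℝ))).isBoundedBilinearMap.hasStrictFDerivAt (Q, Q)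
    have h4 := HasStrictFDerivAt.comp (f := fun X : Matrix ι ι ℝ => (X, X)) Q h3
      ((hasStrictFDerivAt_id Q).prodMk (hasStrictFDerivAt_id Q))
    refine ((h1.add h2).add h4).congr_fderiv ?_
    ext1 H
    change Aᵀ * H + H * A + (Q * H + H * Q) = (A + Q)ᵀ * H + H * (A + Q)
    rw [transpose_add, hQ]
    noncomm_ring
  -- Transposes of solutions are solutions with the same symmetric right-hand side, so local
  -- uniqueness will force symmetry.
  have hfT : ∀ X, f Xᵀ = (f X)ᵀ := by
    intro X
    simp only [f, transpose_add, transpose_mul, transpose_transpose]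
    abel
  have hfQ : f Q = -(s • 1) := eq_neg_of_add_eq_zero_left hric
  have hy : Tendsto (fun t : ℝ => -(t • (1 : Matrix ι ι ℝ))) (𝓝 s) (𝓝 (f Q)) := by
    rw [hfQ]
    exact Continuous.tendsto (by fun_prop) s
  have hg := hf.localInverse_tendsto.comp hy
  have hgT : Tendsto (fun t => (hf.localInverse f e Q (-(t • (1 : Matrix ι ι ℝ))))ᵀ)
      (𝓝 s) (𝓝 Q) := by
    have := (Continuous.matrix_transpose continuous_id).continuousAt.tendsto.comp hg
    simpa [hQ, Function.comp_def] using this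
  have hH : ∀ᶠ X in 𝓝 Q, IsHurwitz (A + X) :=
    (isOpen_isHurwitz.preimage (continuous_const.add continuous_id)).mem_nhds hR
  filter_upwards [hy.eventually hf.eventually_right_inverse,
    hgT.eventually hf.eventually_left_inverse, hg.eventually hH] with t h1 h2 h3
  refine ⟨_, ?_, ?_, h3⟩
  · rw [hfT] at h2
    simp only [Function.comp_apply]
    rw [h1] at h2
    rw [← h2]
    simp
  · simp only [Function.comp_apply]
    change f _ + _ = 0
    rw [h1, neg_add_cancel]

end InverseFunction

/-- Completing the square gives (A + Q)ᵀ(A + Q) + sI = AᵀA, so each column of A + Q is no longer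
than that of A. The bound is uniform in s, which supplies compactness for the continuation. -/
theorem abs_le_of_riccati {A Q : Matrix ι ι ℝ} {s : ℝ} (hs : 0 ≤ s) (hQ : Qᵀ = Q)
    (hric : Aᵀ * Q + Q * A + Q * Q + s • (1 : Matrix ι ι ℝ) = 0) (i j : ι) :
    |Q i j| ≤ 2 * √(∑ i, ∑ j, A i j ^ 2) := by
  set c := ∑ i, ∑ j, A i j ^ 2
  have hR : (A + Q)ᵀ * (A + Q) + s • 1 = Aᵀ * A := by
    have : (A + Q)ᵀ * (A + Q) + s • 1 =
        Aᵀ * A + (Aᵀ * Q + Q * A + Q * Q + s • (1 : Matrix ι ι ℝ)) := by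
      rw [transpose_add, hQ]
      noncomm_ring
    rw [this, hric, add_zero]
  have hjj := congrFun (congrFun hR j) j
  simp only [Matrix.add_apply, mul_apply, transpose_apply, Matrix.smul_apply, one_apply_eq,
    smul_eq_mul, mul_one, ← sq] at hjj
  have h1 : (A i j + Q i j) ^ 2 ≤ ∑ i, (A i j + Q i j) ^ 2 :=
    Finset.single_le_sum (f := fun i => (A i j + Q i j) ^ 2) (fun _ _ => sq_nonneg _)
      (Finset.mem_univ i)
  have h2 : ∑ i, A i j ^ 2 ≤ c := Finset.sum_le_sum fun i _ =>
    Finset.single_le_sum (f := fun j => A i j ^ 2) (fun _ _ => sq_nonneg _) (Finset.mem_univ j)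
  have h3 : A i j ^ 2 ≤ ∑ i, A i j ^ 2 :=
    Finset.single_le_sum (f := fun i => A i j ^ 2) (fun _ _ => sq_nonneg _) (Finset.mem_univ i)
  have h4 := Real.abs_le_sqrt (show (A i j + Q i j) ^ 2 ≤ c by linarith)
  have h5 := Real.abs_le_sqrt (show (A i j) ^ 2 ≤ c by linarith)
  rw [abs_le] at h4 h5 ⊢
  constructor <;> linarith

theorem exists_riccati {A : Matrix ι ι ℝ} (hA : IsHurwitz A) {k : ℝ} (hk0 : 0 ≤ k)
    (hk : √k < gammaDist A) :
    ∃ Q : Matrix ι ι ℝ, Qᵀ = Q ∧ Aᵀ * Q + Q * A + Q * Q + k • (1 : Matrix ι ι ℝ) = 0 := by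
  let E : Set ℝ := {s | ∃ X : Matrix ι ι ℝ, Xᵀ = X ∧
      Aᵀ * X + X * A + X * X + s • (1 : Matrix ι ι ℝ) = 0 ∧ IsHurwitz (A + X)}
  let b : ℝ := 2 * √(∑ i, ∑ j, A i j ^ 2)
  let K : Set (Matrix ι ι ℝ) := Set.pi Set.univ fun _ => Set.pi Set.univ fun _ => Set.Icc (-b) b
  have hK : IsCompact K := isCompact_univ_pi fun _ => isCompact_univ_pi fun _ => isCompact_Icc
  let Z : Set (ℝ × Matrix ι ι ℝ) := {p | p.2ᵀ = p.2 ∧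
      Aᵀ * p.2 + p.2 * A + p.2 * p.2 + p.1 • (1 : Matrix ι ι ℝ) = 0 ∧ IsSemiHurwitz (A + p.2)}
  have hZ : IsClosed Z := by
    refine (isClosed_eq (by fun_prop) (by fun_prop)).inter
      ((isClosed_eq (by fun_prop) (by fun_prop)).inter ?_)
    exact isClosed_isSemiHurwitz.preimage (continuous_const.add continuous_snd)
  -- Closedness: the solvable parameters are the projection of a compact set, where "Hurwitz" may be
  -- weakened to its closed version.
  have hE : E ∩ Set.Icc 0 k = Prod.fst '' ((Set.Icc 0 k ×ˢ K) ∩ Z) := by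
    ext s
    constructor
    · rintro ⟨⟨X, h1, h2, h3⟩, hs⟩
      refine ⟨(s, X), ⟨⟨hs, ?_⟩, h1, h2, h3.isSemiHurwitz⟩, rfl⟩
      exact fun i _ j _ => abs_le.1 (abs_le_of_riccati hs.1 h1 h2 i j)
    · rintro ⟨⟨s, X⟩, ⟨⟨hs, -⟩, h1, h2, h3⟩, rfl⟩
      exact ⟨⟨X, h1, h2, h3.isHurwitz fun μ hμ => re_ne_zero_of_riccati hk hs.2 h2 hμ⟩, hs⟩
  have key : Set.Icc 0 k ⊆ E := by
    refine IsClosed.Icc_subset_of_forall_mem_nhdsWithin ?_ ?_ ?_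
    · rw [hE]
      exact (((isCompact_Icc.prod hK).inter_right hZ).image continuous_fst).isClosed
    · exact ⟨0, by simp, by simp, by simpa using hA⟩
    · rintro s ⟨⟨X, h1, h2, h3⟩, -⟩
      exact mem_nhdsWithin_of_mem_nhds (eventually_exists_riccati h1 h2 h3)
  obtain ⟨X, h1, h2, -⟩ := key ⟨hk0, le_rfl⟩
  exact ⟨X, h1, h2⟩

/-- The case without neighbours. In finite dimension injectivity of the Sylvester operator gives
existence, and uniqueness gives symmetry. -/
theorem exists_lyapunov {A : Matrix ι ι ℝ} (hA : IsHurwitz A) (β : ℝ) :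
    ∃ P : Matrix ι ι ℝ, Pᵀ = P ∧ Aᵀ * P + P * A + β • (1 : Matrix ι ι ℝ) = 0 := by
  let L : Matrix ι ι ℝ →ₗ[ℝ] Matrix ι ι ℝ := LinearMap.mulLeft ℝ Aᵀ + LinearMap.mulRight ℝ A
  have hL : Function.Injective L := by
    rw [← LinearMap.ker_eq_bot, LinearMap.ker_eq_bot']
    intro H hH
    exact sylvester_injective hA hH
  obtain ⟨P, hP⟩ := (LinearMap.injective_iff_surjective.1 hL) (-(β • 1))
  have hP' : Aᵀ * P + P * A = -(β • 1) := hP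
  refine ⟨P, hL ?_, by rw [hP', neg_add_cancel]⟩
  rw [hP]
  change Aᵀ * Pᵀ + Pᵀ * A = _
  have := congrArg transpose hP'
  simp only [transpose_add, transpose_mul, transpose_neg, transpose_smul, transpose_one,
    transpose_transpose] at this
  rw [← this, add_comm]

/-- The strict bounded real lemma, for the Riccati equation `Aᵀ P + P A + N P² + β I = 0`. -/
theorem exists_posDef_riccati {A : Matrix ι ι ℝ} (hA : IsHurwitz A) (N : ℕ) {β : ℝ} (hβ : 0 < β)
    (hk : √(N * β) < gammaDist A) :
    ∃ P : Matrix ι ι ℝ, P.PosDef ∧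
      Aᵀ * P + P * A + (N : ℝ) • (P * P) + β • (1 : Matrix ι ι ℝ) = 0 := by
  obtain ⟨P, hP, hric⟩ : ∃ P : Matrix ι ι ℝ, Pᵀ = P ∧
      Aᵀ * P + P * A + (N : ℝ) • (P * P) + β • (1 : Matrix ι ι ℝ) = 0 := by
    rcases Nat.eq_zero_or_pos N with rfl | hN
    · simpa using exists_lyapunov hA β
    · have hN' : (0 : ℝ) < N := Nat.cast_pos.2 hN
      obtain ⟨Q, hQ, hric⟩ := exists_riccati hA (by positivity) hk
      -- Q = NP normalises the quadratic coefficient to 1 and turns β into Nβ.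
      refine ⟨(N : ℝ)⁻¹ • Q, by rw [transpose_smul, hQ], ?_⟩
      have := congrArg (fun Z => (N : ℝ)⁻¹ • Z) hric
      simp only [smul_add, smul_zero, smul_smul] at this
      rw [← this]
      simp only [mul_smul_comm, smul_mul_assoc, smul_smul]
      field_simp
  refine ⟨P, posDef_of_lyapunov hA hP fun x hx => ?_, hric⟩
  have h0 : 0 < x ⬝ᵥ x := by
    have := dotProduct_star_self_pos_iff.2 hx
    simpa using this
  have h1 := congrArg (fun Z => x ⬝ᵥ (Z *ᵥ x)) hric
  simp only [add_mulVec, smul_mulVec, one_mulVec, zero_mulVec, dotProduct_add, dotProduct_smul,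
    dotProduct_zero, ← mulVec_mulVec, smul_eq_mul] at h1
  have h2 : x ⬝ᵥ (Aᵀ *ᵥ (P *ᵥ x)) = x ⬝ᵥ (P *ᵥ (A *ᵥ x)) := by
    rw [dotProduct_mulVec, vecMul_transpose, dotProduct_mulVec, ← mulVec_transpose, hP,
      dotProduct_comm]
  have h3 : x ⬝ᵥ (P *ᵥ (P *ᵥ x)) = (P *ᵥ x) ⬝ᵥ (P *ᵥ x) := by
    rw [dotProduct_mulVec, ← mulVec_transpose, hP]
  have h4 : 0 ≤ (P *ᵥ x) ⬝ᵥ (P *ᵥ x) := by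
    have := dotProduct_star_self_nonneg (P *ᵥ x)
    simpa using this
  rw [h2, h3] at h1
  nlinarith [mul_pos hβ h0, mul_nonneg (Nat.cast_nonneg (α := ℝ) N) h4]

end Riccati

/-! ### Quadratic form bounds and M-matrix weights. -/

section Forms

variable {ι κ : Type*} [Fintype ι] [Fintype κ]

theorem dotProduct_self_nonneg' (x : ι → ℝ) : 0 ≤ x ⬝ᵥ x :=
  Finset.sum_nonneg fun i _ => mul_self_nonneg (x i)

theorem two_mul_dotProduct_le (x y : ι → ℝ) {a : ℝ} (ha : 0 < a) :
    2 * (x ⬝ᵥ y) ≤ a * (x ⬝ᵥ x) + a⁻¹ * (y ⬝ᵥ y) := by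
  simp only [dotProduct, Finset.mul_sum, ← Finset.sum_add_distrib]
  refine Finset.sum_le_sum fun i _ => ?_
  have h : a * (x i * x i) + a⁻¹ * (y i * y i) - 2 * (x i * y i) = a * (x i - a⁻¹ * y i) ^ 2 := by
    field_simp
    ring
  nlinarith [mul_nonneg ha.le (sq_nonneg (x i - a⁻¹ * y i))]

theorem norm_sq_le_dotProduct (x : ι → ℝ) : ‖x‖ ^ 2 ≤ x ⬝ᵥ x := by
  have h : ‖x‖ ≤ √(x ⬝ᵥ x) := by
    refine (pi_norm_le_iff_of_nonneg (Real.sqrt_nonneg _)).2 fun i => ?_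
    refine Real.abs_le_sqrt ?_
    rw [sq]
    exact Finset.single_le_sum (f := fun i => x i * x i) (fun _ _ => mul_self_nonneg _)
      (Finset.mem_univ i)
  calc ‖x‖ ^ 2 ≤ √(x ⬝ᵥ x) ^ 2 := by gcongr
    _ = _ := Real.sq_sqrt (dotProduct_self_nonneg' x)

theorem dotProduct_le_norm_sq (x : ι → ℝ) : x ⬝ᵥ x ≤ Fintype.card ι * ‖x‖ ^ 2 := by
  have h : ∀ i ∈ Finset.univ, x i * x i ≤ ‖x‖ ^ 2 := fun i _ => by
    have := norm_le_pi_norm x i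
    rw [Real.norm_eq_abs] at this
    nlinarith [abs_mul_abs_self (x i), abs_nonneg (x i)]
  simpa [dotProduct] using Finset.sum_le_sum h

theorem dotProduct_mulVec_comm {P : Matrix ι ι ℝ} (hP : Pᵀ = P) (x y : ι → ℝ) :
    x ⬝ᵥ (P *ᵥ y) = (P *ᵥ x) ⬝ᵥ y := by
  rw [dotProduct_mulVec, ← mulVec_transpose, hP]

theorem exists_pos_forall_le {α : Type*} [Finite α] {f : α → ℝ} (hf : ∀ i, 0 < f i) :
    ∃ a > 0, ∀ i, a ≤ f i := by
  cases isEmpty_or_nonempty α with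
  | inl h => exact ⟨1, one_pos, fun i => h.elim i⟩
  | inr h =>
    obtain ⟨i, hi⟩ := Finite.exists_min f
    exact ⟨f i, hf i, hi⟩

variable [DecidableEq ι]

theorem dotProduct_mulVec_nonneg_of_eigenvalues {C : Matrix ι ι ℝ} (hC : C.IsHermitian)
    (h : ∀ (ν : ℝ) (v : ι → ℝ), v ≠ 0 → C *ᵥ v = ν • v → 0 ≤ ν) (x : ι → ℝ) :
    0 ≤ x ⬝ᵥ (C *ᵥ x) := by
  have hpsd : C.PosSemidef := by
    rw [hC.posSemidef_iff_eigenvalues_nonneg]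
    intro i
    refine h _ (hC.eigenvectorBasis i).ofLp (fun h0 => ?_) (by
      simpa using hC.mulVec_eigenvectorBasis i)
    exact hC.eigenvectorBasis.orthonormal.ne_zero i (by ext k; exact congrFun h0 k)
  simpa using hpsd.dotProduct_mulVec_nonneg x

theorem exists_eigenvalues_eq {B : Matrix ι ι ℝ} (hB : B.IsHermitian) {ν : ℝ} {v : ι → ℝ}
    (hv : v ≠ 0) (h : B *ᵥ v = ν • v) : ∃ i, hB.eigenvalues i = ν := by
  have : ν ∈ spectrum ℝ B := by
    rw [mem_spectrum_iff_isRoot_charpoly, Polynomial.IsRoot, eval_charpoly,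
      ← exists_mulVec_eq_zero_iff]
    refine ⟨v, hv, ?_⟩
    rw [sub_mulVec, scalar_apply, ← smul_one_eq_diagonal, smul_mulVec, one_mulVec, h, sub_self]
  rwa [hB.spectrum_real_eq_range_eigenvalues] at this

theorem dotProduct_mulVec_le {B : Matrix ι ι ℝ} (hB : B.IsHermitian) {b : ℝ}
    (h : ∀ i, hB.eigenvalues i ≤ b) (x : ι → ℝ) : x ⬝ᵥ (B *ᵥ x) ≤ b * (x ⬝ᵥ x) := by
  have hC : (b • (1 : Matrix ι ι ℝ) - B).IsHermitian :=
    (isHermitian_one.smul (IsSelfAdjoint.all b)).sub hB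
  have := dotProduct_mulVec_nonneg_of_eigenvalues hC (fun ν v hv hev => ?_) x
  · simp only [sub_mulVec, smul_mulVec, one_mulVec, dotProduct_sub, dotProduct_smul,
      smul_eq_mul] at this
    linarith
  · obtain ⟨i, hi⟩ := exists_eigenvalues_eq hB (ν := b - ν) hv (by
      rw [sub_smul, ← hev, sub_mulVec, smul_mulVec, one_mulVec, sub_sub_cancel])
    linarith [h i]

theorem le_dotProduct_mulVec {B : Matrix ι ι ℝ} (hB : B.IsHermitian) {a : ℝ}
    (h : ∀ i, a ≤ hB.eigenvalues i) (x : ι → ℝ) : a * (x ⬝ᵥ x) ≤ x ⬝ᵥ (B *ᵥ x) := by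
  have hC : (B - a • (1 : Matrix ι ι ℝ)).IsHermitian :=
    hB.sub (isHermitian_one.smul (IsSelfAdjoint.all a))
  have := dotProduct_mulVec_nonneg_of_eigenvalues hC (fun ν v hv hev => ?_) x
  · simp only [sub_mulVec, smul_mulVec, one_mulVec, dotProduct_sub, dotProduct_smul,
      smul_eq_mul] at this
    linarith
  · obtain ⟨i, hi⟩ := exists_eigenvalues_eq hB (ν := a + ν) hv (by
      rw [add_smul, ← hev, sub_mulVec, smul_mulVec, one_mulVec, add_sub_cancel])
    linarith [h i]

theorem exists_pos_dotProduct_mulVec_le {B : Matrix ι ι ℝ} (hB : B.IsHermitian) :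
    ∃ b > 0, ∀ x : ι → ℝ, x ⬝ᵥ (B *ᵥ x) ≤ b * (x ⬝ᵥ x) :=
  ⟨∑ i, |hB.eigenvalues i| + 1, by positivity, dotProduct_mulVec_le hB fun i =>
    (le_abs_self _).trans ((Finset.single_le_sum (f := fun i => |hB.eigenvalues i|)
      (fun _ _ => abs_nonneg _) (Finset.mem_univ i)).trans (by linarith))⟩

theorem exists_pos_le_dotProduct_mulVec {B : Matrix ι ι ℝ} (hB : B.PosDef) :
    ∃ a > 0, ∀ x : ι → ℝ, a * (x ⬝ᵥ x) ≤ x ⬝ᵥ (B *ᵥ x) := by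
  obtain ⟨a, ha, h⟩ := exists_pos_forall_le hB.eigenvalues_pos
  exact ⟨a, ha, le_dotProduct_mulVec hB.1 h⟩

theorem lambdaMaxGram_nonneg (A : Matrix κ ι ℝ) : 0 ≤ lambdaMaxGram A :=
  Real.iSup_nonneg fun i => eigenvalues_conjTranspose_mul_self_nonneg A i

theorem mulVec_dotProduct_self_le (A : Matrix κ ι ℝ) (x : ι → ℝ) :
    (A *ᵥ x) ⬝ᵥ (A *ᵥ x) ≤ lambdaMaxGram A * (x ⬝ᵥ x) := by
  have h := dotProduct_mulVec_le (isHermitian_conjTranspose_mul_self A) (b := lambdaMaxGram A)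
    (fun i => le_ciSup (Set.finite_range _).bddAbove i) x
  rwa [conjTranspose_eq_transpose_of_trivial, ← mulVec_mulVec, dotProduct_mulVec,
    vecMul_transpose] at h

/-- A strictly diagonally dominant M-matrix `diag b - W` has a positive left weight vector. -/
theorem exists_pos_weights {W : Matrix ι ι ℝ} (hW : ∀ i j, 0 ≤ W i j) {b : ι → ℝ}
    (hb : ∀ i, ∑ j, W i j < b i) :
    ∃ c : ι → ℝ, (∀ i, 0 < c i) ∧ ∀ j, ∑ i, c i * W i j < c j * b j := by
  -- Minimum principle: in the row where y is least, diagonal dominance rules out a negative value.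
  -- Invertibility and an entrywise nonnegative inverse follow.
  have hmono : ∀ y : ι → ℝ, (∀ i, 0 ≤ ((diagonal b - W) *ᵥ y) i) → ∀ i, 0 ≤ y i := by
    intro y hy i
    have : Nonempty ι := ⟨i⟩
    obtain ⟨k, hk⟩ := Finite.exists_min y
    refine le_trans ?_ (hk i)
    by_contra! hneg
    have h1 := hy k
    rw [sub_mulVec, Pi.sub_apply, mulVec_diagonal] at h1
    have h2 : (∑ j, W k j) * y k ≤ (W *ᵥ y) k := by
      rw [Finset.sum_mul]
      exact Finset.sum_le_sum fun j _ => mul_le_mul_of_nonneg_left (hk j) (hW k j)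
    nlinarith [hb k]
  have hdet : IsUnit (diagonal b - W).det := by
    rw [isUnit_iff_ne_zero]
    intro h0
    obtain ⟨v, hv, h⟩ := exists_mulVec_eq_zero_iff.2 h0
    refine hv (funext fun i => le_antisymm ?_ ?_)
    · have := hmono (-v) (fun i => by rw [mulVec_neg, h]; simp) i
      simpa using this
    · exact hmono v (fun i => by rw [h]; simp) i
  have hK : ∀ i j, 0 ≤ (diagonal b - W)⁻¹ i j := by
    intro i j
    have := hmono ((diagonal b - W)⁻¹ *ᵥ Pi.single j 1) (fun k => by
      rw [mulVec_mulVec, mul_nonsing_inv _ hdet, one_mulVec]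
      by_cases h : k = j
      · subst h; simp
      · simp [h]) i
    simpa using this
  -- With this c every column inequality holds with margin exactly 1.
  set c : ι → ℝ := (fun _ => 1) ᵥ* (diagonal b - W)⁻¹ with hc
  have hc0 : ∀ j, 0 ≤ c j := fun j => Finset.sum_nonneg fun i _ => by simpa using hK i j
  have hcz : c ᵥ* (diagonal b - W) = fun _ => 1 := by
    rw [hc, vecMul_vecMul, nonsing_inv_mul _ hdet, vecMul_one]
  have hj : ∀ j, c j * b j - ∑ i, c i * W i j = 1 := by
    intro j
    have := congrFun hcz j
    rwa [vecMul_sub, Pi.sub_apply, vecMul_diagonal] at this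
  refine ⟨c, fun j => lt_of_le_of_ne (hc0 j) fun h => ?_, fun j => by linarith [hj j]⟩
  have h1 := hj j
  rw [← h, zero_mul] at h1
  have h2 : 0 ≤ ∑ i, c i * W i j := Finset.sum_nonneg fun i _ => mul_nonneg (hc0 i) (hW i j)
  linarith

end Forms

/-! ### The composite Lyapunov function. -/

section Interconnection

variable {M : ℕ} {n m q r : Fin M → ℕ} (S : LSS M n m q r)

theorem Acl_mulVec (Am : ∀ i, Matrix (St n q i) (St n q i) ℝ) (x : (Σ i, St n q i) → ℝ)
    (i : Fin M) (a : St n q i) :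
    (S.Acl Am *ᵥ x) ⟨i, a⟩ = (Am i *ᵥ (fun b => x ⟨i, b⟩) +
      ∑ j ∈ S.nbr i, S.Aint i j *ᵥ fun b => x ⟨j, b⟩) a := by
  rw [LSS.Acl, add_mulVec, Pi.add_apply, Pi.add_apply, Finset.sum_apply]
  congr 1
  · rw [mulVec, dotProduct, Fintype.sum_sigma, Finset.sum_eq_single i]
    · simp [mulVec, dotProduct, blockDiagonal'_apply_eq]
    · intro j _ hj
      exact Finset.sum_eq_zero fun b _ => by rw [blockDiagonal'_apply_ne _ _ _ hj.symm, zero_mul]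
    · simp
  · rw [mulVec, dotProduct, Fintype.sum_sigma, LSS.nbr, Finset.sum_filter]
    refine Finset.sum_congr rfl fun j _ => ?_
    simp only [of_apply]
    by_cases hji : j = i
    · subst hji
      simp
    · by_cases hA : S.A i j = 0
      · simp [hA, LSS.Aint, fromBlocks_zero]
      · simp [hA, hji, Ne.symm hji, mulVec, dotProduct]

theorem dotProduct_blockDiagonal'_mulVec (Q : ∀ i, Matrix (St n q i) (St n q i) ℝ)
    (x y : (Σ i, St n q i) → ℝ) :
    x ⬝ᵥ (blockDiagonal' Q *ᵥ y) =
      ∑ i, (fun a => x ⟨i, a⟩) ⬝ᵥ (Q i *ᵥ fun a => y ⟨i, a⟩) := by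
  rw [dotProduct, Fintype.sum_sigma]
  refine Finset.sum_congr rfl fun i _ => Finset.sum_congr rfl fun a _ => ?_
  congr 1
  rw [mulVec, dotProduct, Fintype.sum_sigma, Finset.sum_eq_single i]
  · simp [mulVec, dotProduct, blockDiagonal'_apply_eq]
  · intro j _ hj
    exact Finset.sum_eq_zero fun b _ => by rw [blockDiagonal'_apply_ne _ _ _ hj.symm, zero_mul]
  · simp

theorem posDef_blockDiagonal' {Q : ∀ i, Matrix (St n q i) (St n q i) ℝ}
    (hQ : ∀ i, (Q i).PosDef) : (blockDiagonal' Q).PosDef := by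
  refine PosDef.of_dotProduct_mulVec_pos ?_ fun x hx => ?_
  · rw [IsHermitian, blockDiagonal'_conjTranspose]
    exact congrArg blockDiagonal' (funext fun i => (hQ i).1)
  · rw [star_trivial, dotProduct_blockDiagonal'_mulVec]
    have hnn : ∀ i, 0 ≤ (fun a => x ⟨i, a⟩) ⬝ᵥ (Q i *ᵥ fun a => x ⟨i, a⟩) := fun i => by
      simpa using (hQ i).posSemidef.dotProduct_mulVec_nonneg fun a => x ⟨i, a⟩
    obtain ⟨⟨i, a⟩, ha⟩ := Function.ne_iff.1 hx
    refine Finset.sum_pos' (fun i _ => hnn i) ⟨i, Finset.mem_univ i, ?_⟩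
    simpa using (hQ i).dotProduct_mulVec_pos (x := fun a => x ⟨i, a⟩)
      (fun h => ha (congrFun h a))

/-- The local Riccati equations give a weighted block-diagonal quadratic Lyapunov function of the
interconnection. -/
theorem exists_weights_dissipation {Am P : ∀ i, Matrix (St n q i) (St n q i) ℝ}
    {Ξ ε : Fin M → ℝ} (hΞ : ∀ i, ∑ j ∈ S.nbr i, lambdaMaxGram (S.Aint i j) ≤ Ξ i ^ 2)
    (hP : ∀ i, (P i).PosDef) (hε : ∀ i, 0 < ε i)
    (hric : ∀ i, (Am i)ᵀ * P i + P i * Am i + ((S.nbr i).card : ℝ) • (P i * P i)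
          + (Ξ i ^ 2 + ε i) • (1 : Matrix _ _ ℝ) = 0) :
    ∃ c : Fin M → ℝ, (∀ i, 0 < c i) ∧ ∃ η > 0, ∀ x : (Σ i, St n q i) → ℝ,
      2 * (x ⬝ᵥ (blockDiagonal' (fun i => c i • P i) *ᵥ (S.Acl Am *ᵥ x))) ≤ -η * (x ⬝ᵥ x) := by
  classical
  obtain ⟨c, hc, hcW⟩ := exists_pos_weights
    (W := of fun i j => if j ∈ S.nbr i then lambdaMaxGram (S.Aint i j) else 0)
    (b := fun i => Ξ i ^ 2 + ε i)
    (fun i j => by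
      rw [of_apply]
      split_ifs
      · exact lambdaMaxGram_nonneg _
      · exact le_rfl)
    (fun i => by
      simp only [of_apply, Finset.sum_ite_mem, Finset.univ_inter]
      linarith [hΞ i, hε i])
  simp only [of_apply] at hcW
  obtain ⟨η, hη, hle⟩ := exists_pos_forall_le fun j => sub_pos.2 (hcW j)
  refine ⟨c, hc, η, hη, fun x => ?_⟩
  set z : ∀ i, St n q i → ℝ := fun i a => x ⟨i, a⟩ with hz
  have hPt : ∀ i, (P i)ᵀ = P i := fun i => by
    rw [← conjTranspose_eq_transpose_of_trivial]
    exact (hP i).1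
  have hxx : x ⬝ᵥ x = ∑ i, z i ⬝ᵥ z i := by
    rw [dotProduct, Fintype.sum_sigma]
    rfl
  -- One Young inequality per neighbour costs N_i |P_i z_i|², exactly what the quadratic Riccati
  -- term pays for.
  have hlocal : ∀ i, 2 * (z i ⬝ᵥ (P i *ᵥ (Am i *ᵥ z i + ∑ j ∈ S.nbr i, S.Aint i j *ᵥ z j))) ≤
      -(Ξ i ^ 2 + ε i) * (z i ⬝ᵥ z i) +
        ∑ j ∈ S.nbr i, lambdaMaxGram (S.Aint i j) * (z j ⬝ᵥ z j) := by
    intro i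
    have h1 := congrArg (fun Z => z i ⬝ᵥ (Z *ᵥ z i)) (hric i)
    simp only [add_mulVec, smul_mulVec, one_mulVec, zero_mulVec, dotProduct_add, dotProduct_smul,
      dotProduct_zero, ← mulVec_mulVec, smul_eq_mul] at h1
    have h2 : z i ⬝ᵥ ((Am i)ᵀ *ᵥ (P i *ᵥ z i)) = z i ⬝ᵥ (P i *ᵥ (Am i *ᵥ z i)) := by
      rw [dotProduct_mulVec, vecMul_transpose, dotProduct_mulVec_comm (hPt i) (z i),
        dotProduct_comm]
    rw [h2, dotProduct_mulVec_comm (hPt i) (z i) (P i *ᵥ z i)] at h1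
    have h3 : ∀ j ∈ S.nbr i, 2 * ((P i *ᵥ z i) ⬝ᵥ (S.Aint i j *ᵥ z j)) ≤
        (P i *ᵥ z i) ⬝ᵥ (P i *ᵥ z i) + lambdaMaxGram (S.Aint i j) * (z j ⬝ᵥ z j) := by
      intro j _
      have := two_mul_dotProduct_le (P i *ᵥ z i) (S.Aint i j *ᵥ z j) one_pos
      rw [one_mul, inv_one, one_mul] at this
      linarith [mulVec_dotProduct_self_le (S.Aint i j) (z j)]
    have h4 := Finset.sum_le_sum h3
    rw [Finset.sum_add_distrib, Finset.sum_const, nsmul_eq_mul, ← Finset.mul_sum] at h4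
    rw [mulVec_add, dotProduct_add, dotProduct_mulVec_comm (hPt i) (z i) (∑ j ∈ _, _),
      dotProduct_sum]
    linarith
  rw [dotProduct_blockDiagonal'_mulVec, hxx]
  have hexp : ∀ i, (fun a => (S.Acl Am *ᵥ x) ⟨i, a⟩) =
      Am i *ᵥ z i + ∑ j ∈ S.nbr i, S.Aint i j *ᵥ z j := fun i =>
    funext fun a => Acl_mulVec S Am x i a
  simp only [hexp, smul_mulVec, dotProduct_smul, smul_eq_mul]
  calc 2 * ∑ i, c i * (z i ⬝ᵥ (P i *ᵥ (Am i *ᵥ z i + ∑ j ∈ S.nbr i, S.Aint i j *ᵥ z j)))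
      = ∑ i, c i * (2 * (z i ⬝ᵥ (P i *ᵥ (Am i *ᵥ z i + ∑ j ∈ S.nbr i, S.Aint i j *ᵥ z j)))) := by
        rw [Finset.mul_sum]
        exact Finset.sum_congr rfl fun i _ => by ring
    _ ≤ ∑ i, c i * (-(Ξ i ^ 2 + ε i) * (z i ⬝ᵥ z i) +
        ∑ j ∈ S.nbr i, lambdaMaxGram (S.Aint i j) * (z j ⬝ᵥ z j)) :=
        Finset.sum_le_sum fun i _ => mul_le_mul_of_nonneg_left (hlocal i) (hc i).le
    _ = ∑ j, -(c j * (Ξ j ^ 2 + ε j) - ∑ i, c i *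
        (if j ∈ S.nbr i then lambdaMaxGram (S.Aint i j) else 0)) * (z j ⬝ᵥ z j) := by
        -- Swapping the sums collects, for each j, the weighted column sum that the choice of c
        -- controls.
        have h5 : ∑ i, c i * ∑ j ∈ S.nbr i, lambdaMaxGram (S.Aint i j) * (z j ⬝ᵥ z j) =
            ∑ j, (∑ i, c i * (if j ∈ S.nbr i then lambdaMaxGram (S.Aint i j) else 0)) *
              (z j ⬝ᵥ z j) := by
          simp only [Finset.sum_mul]
          rw [Finset.sum_comm]
          refine Finset.sum_congr rfl fun i _ => ?_
          rw [Finset.mul_sum, ← Finset.univ_inter (S.nbr i), ← Finset.sum_ite_mem]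
          refine Finset.sum_congr rfl fun j _ => ?_
          simp only [Finset.univ_inter]
          split_ifs <;> ring
        simp only [mul_add, Finset.sum_add_distrib, h5, neg_mul, sub_mul, neg_sub,
          Finset.sum_sub_distrib]
        rw [sub_eq_add_neg, add_comm, ← Finset.sum_neg_distrib]
        congr 1
        exact Finset.sum_congr rfl fun i _ => by ring
    _ ≤ ∑ j, -η * (z j ⬝ᵥ z j) := by
        refine Finset.sum_le_sum fun j _ => ?_
        exact mul_le_mul_of_nonneg_right (neg_le_neg (hle j)) (dotProduct_self_nonneg' _)
    _ = -η * ∑ i, z i ⬝ᵥ z i := by rw [Finset.mul_sum]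

end Interconnection

/-! ### Scalar comparison and Barbalat's lemma. -/

section Comparison

theorem antitoneOn_of_hasDerivWithinAt_nonpos' {D : Set ℝ} (hD : Convex ℝ D) {f f' : ℝ → ℝ}
    (hf : ∀ t ∈ D, HasDerivWithinAt f (f' t) D t) (hf' : ∀ t ∈ D, f' t ≤ 0) : AntitoneOn f D := by
  refine antitoneOn_of_deriv_nonpos hD (fun t ht => (hf t ht).continuousWithinAt)
    (fun t ht => ((hf t (interior_subset ht)).mono interior_subset).differentiableWithinAt)
    fun t ht => ?_
  rw [((hf t (interior_subset ht)).hasDerivAt (mem_interior_iff_mem_nhds.1 ht)).deriv]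
  exact hf' t (interior_subset ht)

theorem convex_timeIv (T : EReal) : Convex ℝ (timeIv T) := by
  refine Set.OrdConnected.convex ⟨fun s hs t ht u hu => ⟨hs.1.trans hu.1, ?_⟩⟩
  exact lt_of_le_of_lt (EReal.coe_le_coe_iff.2 hu.2) ht.2

theorem zero_mem_timeIv {T : EReal} {t : ℝ} (ht : t ∈ timeIv T) : (0 : ℝ) ∈ timeIv T :=
  ⟨le_rfl, lt_of_le_of_lt (EReal.coe_le_coe_iff.2 ht.1) ht.2⟩

theorem timeIv_top : timeIv ⊤ = Set.Ici 0 := by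
  ext t
  simp [timeIv, EReal.coe_lt_top]

/-- Grönwall by integrating factor: (V - k/α) exp(αt) is nonincreasing. -/
theorem le_of_hasDerivWithinAt_le {T : EReal} {V V' : ℝ → ℝ} {α k : ℝ} (hα : 0 < α)
    (hV : ∀ t ∈ timeIv T, HasDerivWithinAt V (V' t) (timeIv T) t)
    (hV' : ∀ t ∈ timeIv T, V' t ≤ -α * V t + k) {t : ℝ} (ht : t ∈ timeIv T) :
    V t ≤ k / α + (V 0 - k / α) * Real.exp (-α * t) := by
  have hanti : AntitoneOn (fun t => (V t - k / α) * Real.exp (α * t)) (timeIv T) := by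
    refine antitoneOn_of_hasDerivWithinAt_nonpos' (convex_timeIv T) (f' := fun t =>
      V' t * Real.exp (α * t) + (V t - k / α) * (Real.exp (α * t) * α)) (fun t ht => ?_)
      fun t ht => ?_
    · refine ((hV t ht).sub_const _).mul (HasDerivAt.hasDerivWithinAt ?_)
      simpa using ((hasDerivAt_id t).const_mul α).exp
    · have h1 : V' t * Real.exp (α * t) + (V t - k / α) * (Real.exp (α * t) * α) =
          (V' t - (-α * V t + k)) * Real.exp (α * t) := by
        field_simp
        ring
      rw [h1]
      exact mul_nonpos_of_nonpos_of_nonneg (sub_nonpos.2 (hV' t ht)) (Real.exp_pos _).le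
  have h := hanti (zero_mem_timeIv ht) ht ht.1
  simp only [mul_zero, Real.exp_zero, mul_one] at h
  have h2 : V t - k / α = (V t - k / α) * Real.exp (α * t) * Real.exp (-α * t) := by
    rw [mul_assoc, ← Real.exp_add]
    simp
  have h3 := mul_le_mul_of_nonneg_right h (Real.exp_pos (-α * t)).le
  linarith

/-- A form of Barbalat's lemma. -/
theorem tendsto_zero_of_dissipation {E : Type*} [NormedAddCommGroup E] {z : ℝ → E}
    {V V' : ℝ → ℝ} {η L : ℝ} (hη : 0 < η) (hL : 0 ≤ L)
    (hV : ∀ t ∈ Set.Ici (0 : ℝ), HasDerivWithinAt V (V' t) (Set.Ici 0) t)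
    (hV' : ∀ t ∈ Set.Ici (0 : ℝ), V' t ≤ -η * ‖z t‖ ^ 2) (hV0 : ∀ t ∈ Set.Ici (0 : ℝ), 0 ≤ V t)
    (hz : ∀ s ∈ Set.Ici (0 : ℝ), ∀ t ∈ Set.Ici (0 : ℝ), ‖z t - z s‖ ≤ L * |t - s|) :
    Tendsto z atTop (𝓝 0) := by
  have hanti : AntitoneOn V (Set.Ici 0) :=
    antitoneOn_of_hasDerivWithinAt_nonpos' (convex_Ici 0) hV fun t ht =>
      (hV' t ht).trans (by nlinarith [sq_nonneg ‖z t‖])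
  obtain ⟨l, hl⟩ : ∃ l, Tendsto V atTop (𝓝 l) := by
    have h1 : Antitone fun t => V (max t 0) := fun s t hst =>
      hanti (Set.mem_Ici.2 (le_max_right _ _)) (Set.mem_Ici.2 (le_max_right _ _))
        (max_le_max_right 0 hst)
    have h2 := tendsto_atTop_ciInf h1
      ⟨0, by rintro _ ⟨t, rfl⟩; exact hV0 _ (Set.mem_Ici.2 (le_max_right _ _))⟩
    refine ⟨_, h2.congr' ?_⟩
    filter_upwards [eventually_ge_atTop 0] with t ht
    rw [max_eq_left ht]
  rw [Metric.tendsto_atTop']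
  intro e he
  -- The Lipschitz bound keeps ‖z‖ ≥ e/2 for time τ after any instant with ‖z‖ ≥ e, so V then drops
  -- by a fixed amount. This is impossible late, since V converges.
  set τ := e / (2 * (L + 1)) with hτ
  have hτ0 : 0 < τ := by positivity
  have hLτ : L * τ ≤ e / 2 := by
    rw [hτ, ← mul_div_assoc, div_le_iff₀ (by positivity)]
    nlinarith
  have hdiff : Tendsto (fun t => V t - V (t + τ)) atTop (𝓝 (l - l)) :=
    hl.sub (hl.comp (tendsto_atTop_add_const_right _ τ tendsto_id))
  rw [sub_self] at hdiff
  have hpos : 0 < η * (e / 2) ^ 2 * τ := by positivity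
  obtain ⟨N, hN⟩ := eventually_atTop.1
    ((hdiff.eventually_lt_const hpos).and (eventually_ge_atTop 0))
  refine ⟨N, fun t ht => ?_⟩
  obtain ⟨h1, h0⟩ := hN t ht.le
  rw [dist_zero_right]
  by_contra! hge
  refine h1.not_ge ?_
  have hsub : Set.Icc t (t + τ) ⊆ Set.Ici 0 := fun s hs => h0.trans hs.1
  have hanti2 : AntitoneOn (fun s => V s + η * (e / 2) ^ 2 * s) (Set.Icc t (t + τ)) := by
    refine antitoneOn_of_hasDerivWithinAt_nonpos' (convex_Icc _ _)
      (f' := fun s => V' s + η * (e / 2) ^ 2 * 1) (fun s hs => ?_) fun s hs => ?_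
    · exact ((hV s (hsub hs)).mono hsub).add ((hasDerivWithinAt_id s _).const_mul _)
    · have h3 := hz t h0 s (hsub hs)
      rw [abs_of_nonneg (sub_nonneg.2 hs.1)] at h3
      have h4 : L * (s - t) ≤ e / 2 :=
        (mul_le_mul_of_nonneg_left (by linarith [hs.2]) hL).trans hLτ
      have h5 : ‖z t‖ - ‖z s‖ ≤ ‖z t - z s‖ := norm_sub_norm_le _ _
      rw [norm_sub_rev] at h5
      have h6 : e / 2 ≤ ‖z s‖ := by linarith
      have h7 : (e / 2) ^ 2 ≤ ‖z s‖ ^ 2 := by gcongr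
      have h8 := hV' s (hsub hs)
      nlinarith [mul_le_mul_of_nonneg_left h7 hη.le]
  have h9 := hanti2 ⟨le_rfl, by linarith⟩ ⟨by linarith, le_rfl⟩ (show t ≤ t + τ by linarith)
  simp only at h9
  linarith

end Comparison

/-! ### Linear systems with a quadratic Lyapunov function. -/

section LinearSystems

variable {ι : Type*} [Fintype ι]

theorem hasDerivWithinAt_quadForm {P : Matrix ι ι ℝ} (hP : Pᵀ = P) {z : ℝ → ι → ℝ} {z' : ι → ℝ}
    {D : Set ℝ} {t : ℝ} (hz : HasDerivWithinAt z z' D t) :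
    HasDerivWithinAt (fun t => z t ⬝ᵥ (P *ᵥ z t)) (2 * (z t ⬝ᵥ (P *ᵥ z'))) D t := by
  have hzi := hasDerivWithinAt_pi.1 hz
  have h : HasDerivWithinAt (fun t => z t ⬝ᵥ (P *ᵥ z t))
      (z' ⬝ᵥ (P *ᵥ z t) + z t ⬝ᵥ (P *ᵥ z')) D t := by
    have h1 : ∀ i, HasDerivWithinAt (fun t => (P *ᵥ z t) i) ((P *ᵥ z') i) D t := fun i =>
      HasDerivWithinAt.fun_sum fun j _ => (hzi j).const_mul (P i j)
    have h2 := HasDerivWithinAt.fun_sum (u := Finset.univ) fun i _ => (hzi i).mul (h1 i)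
    rw [Finset.sum_add_distrib] at h2
    exact h2
  refine h.congr_deriv ?_
  rw [dotProduct_mulVec_comm hP z', dotProduct_comm, two_mul]

variable [DecidableEq ι]

/-- Decay estimate for a linear system with a quadratic Lyapunov function and input `w`. -/
theorem exists_lyapunov_estimate {A P : Matrix ι ι ℝ} (hP : P.PosDef) {η : ℝ} (hη : 0 < η)
    (hdis : ∀ x : ι → ℝ, 2 * (x ⬝ᵥ (P *ᵥ (A *ᵥ x))) ≤ -η * (x ⬝ᵥ x)) :
    ∃ a > 0, ∃ α > 0, ∃ κ > 0, ∀ (T : EReal) (R : ℝ) (z w : ℝ → ι → ℝ), 0 ≤ R →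
      (∀ t ∈ timeIv T, HasDerivWithinAt z (A *ᵥ z t + w t) (timeIv T) t) →
      (∀ t ∈ timeIv T, ‖w t‖ ≤ R) → ∀ t ∈ timeIv T,
        a * ‖z t‖ ^ 2 ≤ κ * R ^ 2 + κ * ‖z 0‖ ^ 2 * Real.exp (-α * t) := by
  have hPt : Pᵀ = P := by
    rw [← conjTranspose_eq_transpose_of_trivial]
    exact hP.1
  obtain ⟨a, ha, hPa⟩ := exists_pos_le_dotProduct_mulVec hP
  obtain ⟨b, hb, hPb⟩ := exists_pos_dotProduct_mulVec_le hP.1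
  set g := lambdaMaxGram P
  have hg : 0 ≤ g := lambdaMaxGram_nonneg P
  set m : ℝ := (Fintype.card ι : ℝ)
  have hm : 0 ≤ m := Nat.cast_nonneg _
  -- Half of the dissipation absorbs the input term by Young's inequality, with remainder q R²; the
  -- other half gives the decay rate α.
  set α := η / 2 / b with hα
  have hα0 : 0 < α := by positivity
  set q := (η / 2)⁻¹ * g * m with hq
  have hq0 : 0 ≤ q := by positivity
  refine ⟨a, ha, α, hα0, q / α + b * m + 1, by positivity, fun T R z w hR hz hw t ht => ?_⟩
  have hest := le_of_hasDerivWithinAt_le (k := q * R ^ 2) hα0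
    (fun t ht => hasDerivWithinAt_quadForm hPt (hz t ht)) (fun t ht => ?_) ht
  · have h1 : a * ‖z t‖ ^ 2 ≤ z t ⬝ᵥ (P *ᵥ z t) :=
      (mul_le_mul_of_nonneg_left (norm_sq_le_dotProduct _) ha.le).trans (hPa _)
    have h2 : z 0 ⬝ᵥ (P *ᵥ z 0) ≤ b * m * ‖z 0‖ ^ 2 := by
      rw [mul_assoc]
      exact (hPb _).trans (mul_le_mul_of_nonneg_left (dotProduct_le_norm_sq _) hb.le)
    have he := Real.exp_pos (-α * t)
    have h3 : 0 ≤ q * R ^ 2 / α := by positivity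
    have h4 := mul_le_mul_of_nonneg_right h2 he.le
    have h5 : 0 ≤ q / α * (‖z 0‖ ^ 2 * Real.exp (-α * t)) := by positivity
    have h6 : 0 ≤ b * m * R ^ 2 := by positivity
    have h7 : q * R ^ 2 / α = q / α * R ^ 2 := by ring
    have h8 : 0 ≤ ‖z 0‖ ^ 2 * Real.exp (-α * t) := by positivity
    nlinarith [mul_nonneg h3 he.le, sq_nonneg R]
  · have h1 := hdis (z t)
    have h2 := two_mul_dotProduct_le (z t) (P *ᵥ w t) (half_pos hη)
    have h3 : (P *ᵥ w t) ⬝ᵥ (P *ᵥ w t) ≤ g * (m * R ^ 2) := by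
      refine (mulVec_dotProduct_self_le P (w t)).trans (mul_le_mul_of_nonneg_left ?_ hg)
      refine (dotProduct_le_norm_sq _).trans (mul_le_mul_of_nonneg_left ?_ hm)
      have := hw t ht
      gcongr
    have h4 := mul_le_mul_of_nonneg_left h3 (inv_pos.2 (half_pos hη)).le
    have h5 : α * (z t ⬝ᵥ (P *ᵥ z t)) ≤ η / 2 * (z t ⬝ᵥ z t) := by
      refine (mul_le_mul_of_nonneg_left (hPb (z t)) hα0.le).trans (le_of_eq ?_)
      rw [hα]
      field_simp
    rw [mulVec_add, dotProduct_add]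
    have h6 : (η / 2)⁻¹ * (g * (m * R ^ 2)) = q * R ^ 2 := by rw [hq]; ring
    linarith

/-- The difference of two solutions with equal input solves the homogeneous system, so the estimate
with R = 0 gives uniform exponential decay. -/
theorem isGAS_of_lyapunov {A P : Matrix ι ι ℝ} (hP : P.PosDef) {η : ℝ} (hη : 0 < η)
    (hdis : ∀ x : ι → ℝ, 2 * (x ⬝ᵥ (P *ᵥ (A *ᵥ x))) ≤ -η * (x ⬝ᵥ x)) : IsGAS A := by
  obtain ⟨a, ha, α, hα, κ, hκ, hest⟩ := exists_lyapunov_estimate hP hη hdis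
  have hdiff : ∀ w x y : ℝ → ι → ℝ, IsLinSol A w x → IsLinSol A w y → ∀ t ≥ 0,
      a * ‖x t - y t‖ ^ 2 ≤ κ * ‖x 0 - y 0‖ ^ 2 * Real.exp (-α * t) := by
    intro w x y hx hy t ht
    have := hest ⊤ 0 (fun t => x t - y t) (fun _ => 0) le_rfl (fun t ht => ?_) (by simp) t
      (by rw [timeIv_top]; exact ht)
    · simpa using this
    · rw [timeIv_top] at ht ⊢
      refine ((hx t ht).sub (hy t ht)).congr_deriv ?_
      rw [mulVec_sub]
      abel
  constructor
  · intro ε hε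
    refine ⟨√(a / κ) * ε, by positivity, fun w x y hx hy h0 t ht => ?_⟩
    have h1 := hdiff w x y hx hy t ht
    have h2 : Real.exp (-α * t) ≤ 1 := Real.exp_le_one_iff.2 (by nlinarith)
    have h3 : ‖x 0 - y 0‖ ^ 2 < a / κ * ε ^ 2 := by
      calc ‖x 0 - y 0‖ ^ 2 < (√(a / κ) * ε) ^ 2 := by gcongr
        _ = _ := by rw [mul_pow, Real.sq_sqrt (by positivity)]
    have h4 : κ * ‖x 0 - y 0‖ ^ 2 < a * ε ^ 2 := by
      have := mul_lt_mul_of_pos_left h3 hκ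
      have h5 : κ * (a / κ * ε ^ 2) = a * ε ^ 2 := by field_simp
      linarith
    have h6 : κ * ‖x 0 - y 0‖ ^ 2 * Real.exp (-α * t) ≤ κ * ‖x 0 - y 0‖ ^ 2 :=
      mul_le_of_le_one_right (by positivity) h2
    have h7 : ‖x t - y t‖ ^ 2 < ε ^ 2 := by
      refine lt_of_mul_lt_mul_left ?_ ha.le
      linarith
    exact lt_of_pow_lt_pow_left₀ 2 hε.le h7
  · intro w x y hx hy
    rw [tendsto_zero_iff_norm_tendsto_zero]
    have h1 : Tendsto (fun t => ‖x t - y t‖ ^ 2) atTop (𝓝 0) := by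
      have h2 : Tendsto (fun t => κ * ‖x 0 - y 0‖ ^ 2 / a * Real.exp (-α * t)) atTop (𝓝 0) := by
        have h3 : Tendsto (fun t : ℝ => Real.exp (-α * t)) atTop (𝓝 0) := by
          refine Real.tendsto_exp_atBot.comp ?_
          exact tendsto_id.const_mul_atTop_of_neg (neg_lt_zero.2 hα)
        simpa using h3.const_mul (κ * ‖x 0 - y 0‖ ^ 2 / a)
      refine squeeze_zero' (Eventually.of_forall fun t => sq_nonneg _) ?_ h2
      filter_upwards [eventually_ge_atTop 0] with t ht
      have := hdiff w x y hx hy t ht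
      rw [div_mul_eq_mul_div, le_div_iff₀ ha]
      linarith
    have h2 := h1.sqrt
    simpa [Real.sqrt_sq (norm_nonneg _)] using h2

end LinearSystems

/-! ### Sup-norm bounds for matrix-vector products. -/

section Bounds

variable {κ ι : Type*} [Fintype κ] [Fintype ι]

theorem norm_mulVec_le {A : Matrix κ ι ℝ} {C : ℝ} (hC : 0 ≤ C)
    (hA : ∀ i j, |A i j| ≤ C) (x : ι → ℝ) : ‖A *ᵥ x‖ ≤ Fintype.card ι * C * ‖x‖ := by
  refine (pi_norm_le_iff_of_nonneg (by positivity)).2 fun i => ?_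
  have h : ∀ j ∈ Finset.univ, ‖A i j * x j‖ ≤ C * ‖x‖ := fun j _ => by
    rw [norm_mul]
    exact mul_le_mul (hA i j) (norm_le_pi_norm x j) (norm_nonneg _) hC
  refine (norm_sum_le_of_le _ h).trans (le_of_eq ?_)
  simp
  ring

theorem exists_forall_abs_le (A : Matrix κ ι ℝ) : ∃ C ≥ 0, ∀ i j, |A i j| ≤ C :=
  ⟨∑ i, ∑ j, |A i j|, by positivity, fun i j =>
    (Finset.single_le_sum (f := fun j => |A i j|) (fun _ _ => abs_nonneg _)
      (Finset.mem_univ j)).trans <|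
    Finset.single_le_sum (f := fun i => ∑ j, |A i j|)
      (fun _ _ => Finset.sum_nonneg fun _ _ => abs_nonneg _) (Finset.mem_univ i)⟩

theorem exists_norm_mulVec_le (A : Matrix κ ι ℝ) :
    ∃ C ≥ 0, ∀ x : ι → ℝ, ‖A *ᵥ x‖ ≤ C * ‖x‖ := by
  obtain ⟨C, hC, h⟩ := exists_forall_abs_le A
  exact ⟨_, by positivity, norm_mulVec_le hC h⟩

end Bounds

/-! ### The projection operator. -/

section Projection

variable {κ ι : Type*} [Fintype κ] [Fintype ι]

theorem frob_eq_sum (θ η : Matrix κ ι ℝ) : frob θ η = ∑ a, ∑ b, θ a b * η a b := by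
  rw [frob, trace, Finset.sum_comm]
  rfl

theorem frob_sub_right (θ η ζ : Matrix κ ι ℝ) : frob θ (η - ζ) = frob θ η - frob θ ζ := by
  rw [frob, frob, frob, Matrix.mul_sub, trace_sub]

theorem frob_sub_left (θ η ζ : Matrix κ ι ℝ) : frob (θ - η) ζ = frob θ ζ - frob η ζ := by
  rw [frob, frob, frob, transpose_sub, Matrix.sub_mul, trace_sub]

theorem frob_smul_right (θ η : Matrix κ ι ℝ) (s : ℝ) : frob θ (s • η) = s * frob θ η := by
  rw [frob, frob, Matrix.mul_smul, trace_smul, smul_eq_mul]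

theorem frob_self_nonneg (θ : Matrix κ ι ℝ) : 0 ≤ frob θ θ := by
  rw [frob_eq_sum]
  exact Finset.sum_nonneg fun a _ => Finset.sum_nonneg fun b _ => mul_self_nonneg _

theorem sq_le_frob_self (θ : Matrix κ ι ℝ) (a : κ) (b : ι) : θ a b ^ 2 ≤ frob θ θ := by
  rw [frob_eq_sum, sq]
  refine le_trans ?_ (Finset.single_le_sum (f := fun a => ∑ b, θ a b * θ a b)
    (fun a _ => Finset.sum_nonneg fun b _ => mul_self_nonneg _) (Finset.mem_univ a))
  exact Finset.single_le_sum (f := fun b => θ a b * θ a b) (fun b _ => mul_self_nonneg _)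
    (Finset.mem_univ b)

theorem two_mul_frob_le (θ η : Matrix κ ι ℝ) : 2 * frob θ η ≤ frob θ θ + frob η η := by
  simp only [frob_eq_sum, Finset.mul_sum, ← Finset.sum_add_distrib]
  exact Finset.sum_le_sum fun a _ => Finset.sum_le_sum fun b _ => by
    nlinarith [sq_nonneg (θ a b - η a b)]

theorem frob_vecMulVec (θ : Matrix κ ι ℝ) (x : κ → ℝ) (y : ι → ℝ) :
    frob θ (vecMulVec x y) = y ⬝ᵥ (θᵀ *ᵥ x) := by
  rw [frob, mul_vecMulVec, trace_vecMulVec, dotProduct_comm]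

/-- The projection does not slow down the decrease of the parameter error. -/
theorem frob_le_frob_proj {θmax ε₀ : ℝ} (hθmax : 0 < θmax) (hε₀ : 0 < ε₀) {θ θhat : Matrix κ ι ℝ}
    (hθ : projG θmax ε₀ θ ≤ 0) (y : Matrix κ ι ℝ) :
    frob (θ - θhat) y ≤ frob (θ - θhat) (proj θmax ε₀ θhat y) := by
  rw [proj]
  split_ifs with h
  · obtain ⟨hg, hy⟩ := h
    have hden : 0 < ε₀ * θmax ^ 2 := by positivity
    have h1 : (ε₀ + 1) * frob θ θ - θmax ^ 2 ≤ 0 := by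
      have := (div_le_iff₀ hden).1 hθ
      linarith
    have h2 : 0 ≤ (ε₀ + 1) * frob θhat θhat - θmax ^ 2 := by
      have := (le_div_iff₀ hden).1 hg
      linarith
    -- From g(θ) ≤ 0 ≤ g(θ̂). Hence ⟨θ - θ̂, θ̂⟩ ≤ 0, and removing a nonnegative multiple of the
    -- gradient, itself a positive multiple of θ̂, can only raise the inner product.
    have h3 : frob θ θ ≤ frob θhat θhat := by
      refine le_of_mul_le_mul_left (a := ε₀ + 1) ?_ (by positivity)
      linarith
    have h4 : frob (θ - θhat) θhat ≤ 0 := by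
      rw [frob_sub_left]
      linarith [two_mul_frob_le θ θhat]
    rw [frob_sub_right, frob_smul_right]
    have h5 : 0 ≤ projG θmax ε₀ θhat * frob (projGrad θmax ε₀ θhat) y /
        frob (projGrad θmax ε₀ θhat) (projGrad θmax ε₀ θhat) :=
      div_nonneg (mul_nonneg hg hy.le) (frob_self_nonneg _)
    have h6 : frob (θ - θhat) (projGrad θmax ε₀ θhat) ≤ 0 := by
      rw [projGrad, frob_smul_right]
      exact mul_nonpos_of_nonneg_of_nonpos (by positivity) h4
    linarith [mul_nonpos_of_nonneg_of_nonpos h5 h6]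
  · exact le_rfl

end Projection

/-! ### Error dynamics and the adaptive closed loop. -/

section AdaptiveLoop

variable {M : ℕ} {n m q r : Fin M → ℕ} {S : LSS M n m q r}
  {Am P : ∀ i, Matrix (St n q i) (St n q i) ℝ} {D : Design n m q}
  {θ : ∀ i, Matrix (St n q i) (Fin (m i)) ℝ}
  {d : ∀ i, ℝ → Fin (r i) → ℝ} {ref : ∀ i, ℝ → Fin (q i) → ℝ} {T : EReal} {X : Traj n m q}

/-- The signals of all subsystems, stacked. -/
def stack (z : ∀ i, ℝ → St n q i → ℝ) (t : ℝ) : (Σ i, St n q i) → ℝ := fun a => z a.1 t a.2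

/-- The disturbance drops out, which is why bounded references alone suffice later. -/
theorem exo_eq (S : LSS M n m q r) (i : Fin M) (d : Fin (r i) → ℝ) (ref : Fin (q i) → ℝ) :
    S.exo i d ref = Sum.elim (fun _ => (0 : ℝ)) ref := by
  rw [LSS.exo, LSS.Fmat, LSS.Ebar, mulVec_mulVec, fromBlocks_multiply, fromBlocks_mulVec]
  ext a
  cases a <;> simp

theorem norm_exo_le (S : LSS M n m q r) (i : Fin M) (d : Fin (r i) → ℝ) (ref : Fin (q i) → ℝ) :
    ‖S.exo i d ref‖ ≤ ‖ref‖ := by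
  rw [exo_eq]
  refine (pi_norm_le_iff_of_nonneg (norm_nonneg _)).2 fun a => ?_
  cases a with
  | inl a => simp
  | inr a => exact norm_le_pi_norm ref a

theorem hasDerivWithinAt_xtil (hX : IsClosedLoopSol S Am P D d ref T X)
    (hθ : ∀ i, S.Abar i - S.Bbar i * D.K i - Am i = S.Bbar i * (θ i)ᵀ) (i : Fin M) {t : ℝ}
    (ht : t ∈ timeIv T) :
    HasDerivWithinAt (X.xtil i) ((Am i *ᵥ X.xtil i t + ∑ j ∈ S.nbr i, S.Aint i j *ᵥ X.xtil j t)
      + S.Bbar i *ᵥ ((θ i - X.θhat i t)ᵀ *ᵥ X.xbar i t)) (timeIv T) t := by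
  refine ((hX.plant i t ht).sub (hX.predictor i t ht)).congr_deriv ?_
  have h1 : S.Abar i *ᵥ X.xbar i t =
      S.Bbar i *ᵥ (D.K i *ᵥ X.xbar i t) + Am i *ᵥ X.xbar i t +
        S.Bbar i *ᵥ ((θ i)ᵀ *ᵥ X.xbar i t) := by
    rw [mulVec_mulVec, mulVec_mulVec, ← hθ i, ← add_mulVec, ← add_mulVec]
    congr 1
    abel
  simp only [Traj.xtil, Traj.ubl, Traj.umrac, mulVec_sub, mulVec_add, mulVec_neg,
    Finset.sum_sub_distrib, transpose_sub, sub_mulVec, h1]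
  abel

theorem hasDerivWithinAt_stack {z : ∀ i, ℝ → St n q i → ℝ} {f : ∀ i, St n q i → ℝ} {s : Set ℝ}
    {t : ℝ} (h : ∀ i, HasDerivWithinAt (z i)
      ((Am i *ᵥ z i t + ∑ j ∈ S.nbr i, S.Aint i j *ᵥ z j t) + f i) s t) :
    HasDerivWithinAt (stack z) (S.Acl Am *ᵥ stack z t + fun a => f a.1 a.2) s t := by
  refine hasDerivWithinAt_pi.2 fun ⟨i, a⟩ => ?_
  refine (hasDerivWithinAt_pi.1 (h i) a).congr_deriv ?_
  change _ = (S.Acl Am *ᵥ stack z t) ⟨i, a⟩ + f i a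
  rw [Acl_mulVec]
  rfl

/-- The adaptive input cancels in the predictor, which thus obeys the closed-loop model whatever the
estimates do. -/
theorem hasDerivWithinAt_stack_xhat (hX : IsClosedLoopSol S Am P D d ref T X) {t : ℝ}
    (ht : t ∈ timeIv T) :
    HasDerivWithinAt (stack X.xhat) (S.Acl Am *ᵥ stack X.xhat t +
      fun a => S.exo a.1 (d a.1 t) (ref a.1 t) a.2) (timeIv T) t := by
  refine hasDerivWithinAt_stack (f := fun i => S.exo i (d i t) (ref i t)) fun i =>
    (hX.predictor i t ht).congr_deriv ?_
  rw [Traj.umrac, neg_add_cancel, mulVec_zero]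
  abel

/-- The Lyapunov function of the error dynamics. -/
def errorEnergy (P : ∀ i, Matrix (St n q i) (St n q i) ℝ) (D : Design n m q)
    (θ : ∀ i, Matrix (St n q i) (Fin (m i)) ℝ) (c : Fin M → ℝ) (X : Traj n m q) (t : ℝ) : ℝ :=
  stack X.xtil t ⬝ᵥ (blockDiagonal' (fun i => c i • P i) *ᵥ stack X.xtil t) +
    ∑ i, c i * (D.Γ i)⁻¹ * frob (θ i - X.θhat i t) (θ i - X.θhat i t)

/-- The weight c_i/Γ_i makes the update law cancel the cross term 2 c_i x̃_iᵀ P_i B̄_i θ̃_iᵀ x̄_i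
subsystem by subsystem; the projection contributes a nonpositive remainder. -/
theorem exists_hasDerivWithinAt_errorEnergy {c : Fin M → ℝ} (hc : ∀ i, 0 < c i)
    (hP : ∀ i, (P i).PosDef) {η : ℝ} (hdis : ∀ x : (Σ i, St n q i) → ℝ,
      2 * (x ⬝ᵥ (blockDiagonal' (fun i => c i • P i) *ᵥ (S.Acl Am *ᵥ x))) ≤ -η * (x ⬝ᵥ x))
    (hX : IsClosedLoopSol S Am P D d ref T X)
    (hθ : ∀ i, S.Abar i - S.Bbar i * D.K i - Am i = S.Bbar i * (θ i)ᵀ)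
    (hg : ∀ i, projG (D.θmax i) (D.ε₀ i) (θ i) ≤ 0) :
    ∃ U' : ℝ → ℝ, ∀ t ∈ timeIv T,
      HasDerivWithinAt (errorEnergy P D θ c X) (U' t) (timeIv T) t ∧
      U' t ≤ -η * (stack X.xtil t ⬝ᵥ stack X.xtil t) := by
  have hPt : ∀ i, (P i)ᵀ = P i := fun i => by
    rw [← conjTranspose_eq_transpose_of_trivial]
    exact (hP i).1
  have hbd : (blockDiagonal' fun i => c i • P i)ᵀ = blockDiagonal' fun i => c i • P i := by
    rw [blockDiagonal'_transpose]
    simp only [transpose_smul, hPt]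
  let y : ∀ i, ℝ → Matrix (St n q i) (Fin (m i)) ℝ := fun i t =>
    vecMulVec (X.xbar i t) (X.xtil i t ᵥ* P i ᵥ* S.Bbar i)
  let f : ∀ i, ℝ → St n q i → ℝ := fun i t =>
    S.Bbar i *ᵥ ((θ i - X.θhat i t)ᵀ *ᵥ X.xbar i t)
  refine ⟨fun t => 2 * (stack X.xtil t ⬝ᵥ (blockDiagonal' (fun i => c i • P i) *ᵥ
      (S.Acl Am *ᵥ stack X.xtil t + fun a => f a.1 t a.2))) +
    ∑ i, c i * (D.Γ i)⁻¹ * (-2 * (D.Γ i *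
      frob (θ i - X.θhat i t) (proj (D.θmax i) (D.ε₀ i) (X.θhat i t) (y i t)))),
    fun t ht => ⟨?_, ?_⟩⟩
  · refine (hasDerivWithinAt_quadForm hbd (hasDerivWithinAt_stack fun i =>
      hasDerivWithinAt_xtil hX hθ i ht)).add (HasDerivWithinAt.fun_sum fun i _ => ?_)
    refine HasDerivWithinAt.const_mul _ ?_
    have h1 : ∀ a b, HasDerivWithinAt (fun s => (θ i - X.θhat i s) a b * (θ i - X.θhat i s) a b)
        (-2 * (D.Γ i * ((θ i - X.θhat i t) a b *
          proj (D.θmax i) (D.ε₀ i) (X.θhat i t) (y i t) a b))) (timeIv T) t := by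
      intro a b
      have h2 := (hX.update i t ht a b).const_sub (θ i a b)
      refine (h2.mul h2).congr_deriv ?_
      simp only [Matrix.sub_apply, y]
      ring
    simp only [frob_eq_sum]
    refine (HasDerivWithinAt.fun_sum fun a _ => HasDerivWithinAt.fun_sum fun b _ =>
      h1 a b).congr_deriv ?_
    simp only [Finset.mul_sum]
  · beta_reduce
    rw [mulVec_add, dotProduct_add, mul_add]
    have h1 := hdis (stack X.xtil t)
    rw [dotProduct_blockDiagonal'_mulVec (y := fun a => f a.1 t a.2), add_assoc, Finset.mul_sum,
      ← Finset.sum_add_distrib]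
    have h2 : ∀ i ∈ Finset.univ, 2 * ((fun a => stack X.xtil t ⟨i, a⟩) ⬝ᵥ
        ((c i • P i) *ᵥ fun a => f i t a)) + c i * (D.Γ i)⁻¹ * (-2 * (D.Γ i *
      frob (θ i - X.θhat i t) (proj (D.θmax i) (D.ε₀ i) (X.θhat i t) (y i t)))) ≤ 0 := by
      intro i _
      have h3 := frob_le_frob_proj (D.θmax_pos i) (D.ε₀_pos i) (θhat := X.θhat i t) (hg i) (y i t)
      have h4 : frob (θ i - X.θhat i t) (y i t) = X.xtil i t ⬝ᵥ (P i *ᵥ f i t) := by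
        simp only [y, f]
        rw [frob_vecMulVec, ← dotProduct_mulVec, ← dotProduct_mulVec]
      have h5 : (fun a => stack X.xtil t ⟨i, a⟩) ⬝ᵥ ((c i • P i) *ᵥ fun a => f i t a) =
          c i * (X.xtil i t ⬝ᵥ (P i *ᵥ f i t)) := by
        rw [smul_mulVec, dotProduct_smul, smul_eq_mul]
        rfl
      have h6 : ∀ F : ℝ, c i * (D.Γ i)⁻¹ * (-2 * (D.Γ i * F)) = -2 * (c i * F) := by
        intro F
        have := (D.Γ_pos i).ne'
        field_simp
      rw [h5, h6, ← h4]
      linarith [mul_le_mul_of_nonneg_left h3 (hc i).le]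
    have h7 := Finset.sum_nonpos h2
    linarith

theorem isAdaptiveGAS_of_dissipation {c : Fin M → ℝ} (hc : ∀ i, 0 < c i)
    (hP : ∀ i, (P i).PosDef) {η : ℝ} (hη : 0 < η) (hdis : ∀ x : (Σ i, St n q i) → ℝ,
      2 * (x ⬝ᵥ (blockDiagonal' (fun i => c i • P i) *ᵥ (S.Acl Am *ᵥ x))) ≤ -η * (x ⬝ᵥ x))
    (hθ : ∀ i, S.Abar i - S.Bbar i * D.K i - Am i = S.Bbar i * (θ i)ᵀ)
    (hg : ∀ i, projG (D.θmax i) (D.ε₀ i) (θ i) ≤ 0) : IsAdaptiveGAS S Am P D θ := by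
  have hQ : (blockDiagonal' fun i => c i • P i).PosDef :=
    posDef_blockDiagonal' fun i => (hP i).smul (hc i)
  obtain ⟨a, ha, hQa⟩ := exists_pos_le_dotProduct_mulVec hQ
  obtain ⟨b, hb, hQb⟩ := exists_pos_dotProduct_mulVec_le hQ.1
  have hk : ∀ i, 0 < c i * (D.Γ i)⁻¹ := fun i => mul_pos (hc i) (inv_pos.2 (D.Γ_pos i))
  obtain ⟨a', ha', hka⟩ := exists_pos_forall_le hk
  have hpar : ∀ (X : Traj n m q) t i, 0 ≤ c i * (D.Γ i)⁻¹ *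
      frob (θ i - X.θhat i t) (θ i - X.θhat i t) := fun X t i =>
    mul_nonneg (hk i).le (frob_self_nonneg _)
  have hquad : ∀ (X : Traj n m q) t, 0 ≤ stack X.xtil t ⬝ᵥ
      (blockDiagonal' (fun i => c i • P i) *ᵥ stack X.xtil t) := fun X t =>
    (mul_nonneg ha.le (dotProduct_self_nonneg' _)).trans (hQa _)
  have hU0 : ∀ (X : Traj n m q) t, 0 ≤ errorEnergy P D θ c X t := fun X t =>
    add_nonneg (hquad X t) (Finset.sum_nonneg fun i _ => hpar X t i)
  have hUx : ∀ (X : Traj n m q) t, a * ‖stack X.xtil t‖ ^ 2 ≤ errorEnergy P D θ c X t := by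
    intro X t
    refine le_trans ?_ (le_add_of_nonneg_right (Finset.sum_nonneg fun i _ => hpar X t i))
    exact (mul_le_mul_of_nonneg_left (norm_sq_le_dotProduct _) ha.le).trans (hQa _)
  have hUθ : ∀ (X : Traj n m q) t i k l,
      a' * (θ i k l - X.θhat i t k l) ^ 2 ≤ errorEnergy P D θ c X t := by
    intro X t i k l
    refine le_trans ?_ (le_add_of_nonneg_left (hquad X t))
    refine le_trans ?_ (Finset.single_le_sum (fun i _ => hpar X t i) (Finset.mem_univ i))
    exact mul_le_mul (hka i) (sq_le_frob_self (θ i - X.θhat i t) k l) (sq_nonneg _) (hk i).le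
  have hxi : ∀ (z : ∀ i, ℝ → St n q i → ℝ) t i, ‖z i t‖ ≤ ‖stack z t‖ := fun z t i =>
    (pi_norm_le_iff_of_nonneg (norm_nonneg _)).2 fun k => norm_le_pi_norm (stack z t) ⟨i, k⟩
  have hmono : ∀ {d ref T X}, IsClosedLoopSol S Am P D d ref T X → ∀ t ∈ timeIv T,
      errorEnergy P D θ c X t ≤ errorEnergy P D θ c X 0 := by
    intro d ref T X hX t ht
    obtain ⟨U', hU'⟩ := exists_hasDerivWithinAt_errorEnergy hc hP hdis hX hθ hg
    exact antitoneOn_of_hasDerivWithinAt_nonpos' (convex_timeIv T) (fun t ht => (hU' t ht).1)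
      (fun t ht => (hU' t ht).2.trans (by nlinarith [dotProduct_self_nonneg' (stack X.xtil t)]))
      (zero_mem_timeIv ht) ht ht.1
  have hbound : ∀ d ref T X, IsClosedLoopSol S Am P D d ref T X →
      (∃ R, ∀ i, ∀ t ∈ timeIv T, ‖ref i t‖ ≤ R) →
      ∃ R, ∀ i, ∀ t ∈ timeIv T, ‖X.xbar i t‖ ≤ R ∧ ‖X.xhat i t‖ ≤ R ∧
        ∀ k l, |X.θhat i t k l| ≤ R := by
    rintro d ref T X hX ⟨R, hR⟩
    obtain ⟨a₁, ha₁, α, hα, κ, hκ, hest⟩ := exists_lyapunov_estimate hQ hη hdis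
    set u := errorEnergy P D θ c X 0
    have h1 : ∀ t ∈ timeIv T, ‖stack X.xtil t‖ ≤ √(u / a) := fun t ht => by
      refine Real.le_sqrt_of_sq_le ((le_div_iff₀ ha).2 ?_)
      linarith [hUx X t, hmono hX t ht]
    have h2 : ∀ t ∈ timeIv T, ∀ i k l, |θ i k l - X.θhat i t k l| ≤ √(u / a') :=
      fun t ht i k l => by
        refine Real.abs_le_sqrt ((le_div_iff₀ ha').2 ?_)
        linarith [hUθ X t i k l, hmono hX t ht]
    -- |R| is used because R may be negative when the bound on the references is vacuous.
    set v := (κ * |R| ^ 2 + κ * ‖stack X.xhat 0‖ ^ 2) / a₁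
    have h3 : ∀ t ∈ timeIv T, ‖stack X.xhat t‖ ≤ √v := fun t ht => by
      refine Real.le_sqrt_of_sq_le ((le_div_iff₀ ha₁).2 ?_)
      have h4 := hest T |R| (stack X.xhat) _ (abs_nonneg R)
        (fun t ht => hasDerivWithinAt_stack_xhat hX ht) (fun t ht => ?_) t ht
      · have h5 : Real.exp (-α * t) ≤ 1 := Real.exp_le_one_iff.2 (by nlinarith [ht.1])
        have h6 : κ * ‖stack X.xhat 0‖ ^ 2 * Real.exp (-α * t) ≤ κ * ‖stack X.xhat 0‖ ^ 2 :=
          mul_le_of_le_one_right (by positivity) h5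
        linarith
      · refine (pi_norm_le_iff_of_nonneg (abs_nonneg R)).2 fun ⟨i, k⟩ => ?_
        exact (norm_le_pi_norm (S.exo i (d i t) (ref i t)) k).trans
          ((norm_exo_le S i _ _).trans ((hR i t ht).trans (le_abs_self R)))
    set w := ∑ i, ∑ k, ∑ l, |θ i k l|
    have hw : ∀ i k l, |θ i k l| ≤ w := fun i k l =>
      (Finset.single_le_sum (f := fun l => |θ i k l|) (fun _ _ => abs_nonneg _)
        (Finset.mem_univ l)).trans <|
      (Finset.single_le_sum (f := fun k => ∑ l, |θ i k l|)
        (fun _ _ => Finset.sum_nonneg fun _ _ => abs_nonneg _) (Finset.mem_univ k)).trans <|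
      (Finset.single_le_sum (f := fun i => ∑ k, ∑ l, |θ i k l|)
        (fun _ _ => Finset.sum_nonneg fun _ _ => Finset.sum_nonneg fun _ _ => abs_nonneg _)
        (Finset.mem_univ i))
    have hw0 : 0 ≤ w := Finset.sum_nonneg fun _ _ => Finset.sum_nonneg fun _ _ =>
      Finset.sum_nonneg fun _ _ => abs_nonneg _
    have hs1 := Real.sqrt_nonneg (u / a)
    have hs2 := Real.sqrt_nonneg (u / a')
    have hs3 := Real.sqrt_nonneg v
    refine ⟨√(u / a) + √(u / a') + √v + w, fun i t ht => ⟨?_, ?_, fun k l => ?_⟩⟩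
    · have h4 : X.xbar i t = X.xtil i t + X.xhat i t := by rw [Traj.xtil, sub_add_cancel]
      rw [h4]
      have := norm_add_le (X.xtil i t) (X.xhat i t)
      linarith [hxi X.xtil t i, hxi X.xhat t i, h1 t ht, h3 t ht]
    · linarith [hxi X.xhat t i, h3 t ht]
    · have h4 := h2 t ht i k l
      have h5 := hw i k l
      rw [abs_le] at h4 h5 ⊢
      constructor <;> linarith
  have hconv : ∀ d ref X, IsClosedLoopSol S Am P D d ref ⊤ X →
      (∃ R, ∀ i, ∀ t ≥ 0, ‖ref i t‖ ≤ R) → ∀ i, Tendsto (X.xtil i) atTop (𝓝 0) := by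
    rintro d ref X hX ⟨R₀, hR₀⟩
    obtain ⟨R, hR⟩ := hbound d ref ⊤ X hX ⟨R₀, fun i t ht => hR₀ i t ht.1⟩
    obtain ⟨U', hU'⟩ := exists_hasDerivWithinAt_errorEnergy hc hP hdis hX hθ hg
    have hder := fun t (ht : t ∈ timeIv ⊤) =>
      hasDerivWithinAt_stack (fun i => hasDerivWithinAt_xtil hX hθ i ht)
    -- Boundedness of all signals bounds the derivative of x̃, giving the Lipschitz constant for
    -- Barbalat's argument.
    obtain ⟨L, hL0, hL⟩ : ∃ L ≥ 0, ∀ t ∈ timeIv ⊤, ‖S.Acl Am *ᵥ stack X.xtil t +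
        fun a : (Σ i, St n q i) =>
          (S.Bbar a.1 *ᵥ ((θ a.1 - X.θhat a.1 t)ᵀ *ᵥ X.xbar a.1 t)) a.2‖ ≤ L := by
      obtain ⟨CA, hCA0, hCA⟩ := exists_norm_mulVec_le (S.Acl Am)
      have hloc : ∀ i, ∃ l ≥ 0, ∀ t ∈ timeIv ⊤,
          ‖S.Bbar i *ᵥ ((θ i - X.θhat i t)ᵀ *ᵥ X.xbar i t)‖ ≤ l := by
        intro i
        obtain ⟨CB, hCB0, hCB⟩ := exists_norm_mulVec_le (S.Bbar i)
        obtain ⟨w, hw0, hw⟩ := exists_forall_abs_le (θ i)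
        have hR0 : 0 ≤ R := (norm_nonneg _).trans (hR i 0 ⟨le_rfl, EReal.coe_lt_top _⟩).1
        refine ⟨CB * (Fintype.card (St n q i) * (w + R) * R), by positivity, fun t ht => ?_⟩
        refine (hCB _).trans (mul_le_mul_of_nonneg_left ?_ hCB0)
        refine (norm_mulVec_le (C := w + R) (by positivity) (fun k l => ?_) _).trans
          (mul_le_mul_of_nonneg_left (hR i t ht).1 (by positivity))
        rw [transpose_apply, Matrix.sub_apply]
        exact (abs_sub _ _).trans (add_le_add (hw l k) ((hR i t ht).2.2 l k))
      choose l hl0 hl using hloc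
      have hsum : ∀ i, l i ≤ ∑ i, l i := fun i =>
        Finset.single_le_sum (fun i _ => hl0 i) (Finset.mem_univ i)
      have hl0' : 0 ≤ ∑ i, l i := Finset.sum_nonneg fun i _ => hl0 i
      obtain ⟨R', hR'⟩ : ∃ R', ∀ t ∈ timeIv ⊤, ‖stack X.xtil t‖ ≤ R' := by
        refine ⟨|R| + |R|, fun t ht =>
          (pi_norm_le_iff_of_nonneg (by positivity)).2 fun ⟨i, k⟩ => ?_⟩
        refine (norm_le_pi_norm (X.xtil i t) k).trans ((norm_sub_le _ _).trans ?_)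
        exact add_le_add ((hR i t ht).1.trans (le_abs_self R))
          ((hR i t ht).2.1.trans (le_abs_self R))
      refine ⟨CA * |R'| + ∑ i, l i, by positivity, fun t ht => (norm_add_le _ _).trans
        (add_le_add ((hCA _).trans ?_) ?_)⟩
      · exact mul_le_mul_of_nonneg_left ((hR' t ht).trans (le_abs_self R')) hCA0
      · refine (pi_norm_le_iff_of_nonneg hl0').2 fun ⟨i, k⟩ => ?_
        exact (norm_le_pi_norm (S.Bbar i *ᵥ ((θ i - X.θhat i t)ᵀ *ᵥ X.xbar i t)) k).trans
          ((hl i t ht).trans (hsum i))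
    have hstack : Tendsto (stack X.xtil) atTop (𝓝 0) := by
      rw [timeIv_top] at hU' hder hL
      refine tendsto_zero_of_dissipation hη hL0 (fun t ht => (hU' t ht).1)
        (fun t ht => (hU' t ht).2.trans ?_) (fun t _ => hU0 X t) fun s hs t ht => ?_
      · have := mul_le_mul_of_nonneg_left (norm_sq_le_dotProduct (stack X.xtil t)) hη.le
        linarith
      · exact (convex_Ici 0).norm_image_sub_le_of_norm_hasDerivWithin_le hder hL hs ht
    intro i
    exact squeeze_zero_norm (fun t => hxi X.xtil t i) (tendsto_zero_iff_norm_tendsto_zero.1 hstack)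
  refine ⟨fun ε hε => ?_, hbound, hconv, fun d ref X hX hR x hx i => ?_⟩
  · obtain ⟨C, hC0, hC⟩ : ∃ C > 0, ∀ (X : Traj n m q) (δ : ℝ), 0 < δ →
        (∀ i, ‖X.xtil i 0‖ < δ ∧ ∀ k l, |θ i k l - X.θhat i 0 k l| < δ) →
        errorEnergy P D θ c X 0 ≤ C * δ ^ 2 := by
      refine ⟨b * Fintype.card (Σ i, St n q i) +
        ∑ i, c i * (D.Γ i)⁻¹ * (Fintype.card (St n q i) * m i) + 1, ?_, fun X δ hδ h0 => ?_⟩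
      · have : 0 ≤ ∑ i, c i * (D.Γ i)⁻¹ * (Fintype.card (St n q i) * m i) :=
          Finset.sum_nonneg fun i _ => mul_nonneg (hk i).le (by positivity)
        positivity
      · have h1 : ‖stack X.xtil 0‖ ≤ δ := (pi_norm_le_iff_of_nonneg hδ.le).2 fun ⟨i, k⟩ =>
          (norm_le_pi_norm (X.xtil i 0) k).trans (h0 i).1.le
        have h2 : stack X.xtil 0 ⬝ᵥ (blockDiagonal' (fun i => c i • P i) *ᵥ stack X.xtil 0) ≤
            b * Fintype.card (Σ i, St n q i) * δ ^ 2 := by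
          rw [mul_assoc]
          refine (hQb _).trans (mul_le_mul_of_nonneg_left ?_ hb.le)
          refine (dotProduct_le_norm_sq _).trans ?_
          gcongr
        have h3 : ∀ i, frob (θ i - X.θhat i 0) (θ i - X.θhat i 0) ≤
            Fintype.card (St n q i) * m i * δ ^ 2 := by
          intro i
          rw [frob_eq_sum]
          have h4 : ∀ k ∈ Finset.univ, ∀ l ∈ Finset.univ,
              (θ i - X.θhat i 0) k l * (θ i - X.θhat i 0) k l ≤ δ ^ 2 := by
            intro k _ l _
            rw [← sq, ← sq_abs]
            exact pow_le_pow_left₀ (abs_nonneg _) ((h0 i).2 k l).le 2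
          refine (Finset.sum_le_sum fun k hk => Finset.sum_le_sum (h4 k hk)).trans (le_of_eq ?_)
          simp
          ring
        have h5 : ∑ i, c i * (D.Γ i)⁻¹ * frob (θ i - X.θhat i 0) (θ i - X.θhat i 0) ≤
            (∑ i, c i * (D.Γ i)⁻¹ * (Fintype.card (St n q i) * m i)) * δ ^ 2 := by
          rw [Finset.sum_mul]
          refine Finset.sum_le_sum fun i _ => ?_
          rw [mul_assoc _ _ (δ ^ 2)]
          exact mul_le_mul_of_nonneg_left (h3 i) (hk i).le
        rw [errorEnergy, add_mul, add_mul]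
        linarith [sq_nonneg δ]
    set e := min a a'
    have he : 0 < e := lt_min ha ha'
    -- This δ makes C δ² equal to eε²/2, so the initial energy lies strictly below the level eε².
    refine ⟨√(e / (2 * C)) * ε, by positivity, fun d ref T X hX h0 t ht i => ?_⟩
    have h1 := hC X _ (by positivity) h0
    rw [mul_pow, Real.sq_sqrt (by positivity)] at h1
    have h2 : C * (e / (2 * C) * ε ^ 2) = e * ε ^ 2 / 2 := by field_simp
    have h3 : errorEnergy P D θ c X t < e * ε ^ 2 := by
      have : 0 < e * ε ^ 2 := by positivity
      linarith [hmono hX t ht]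
    constructor
    · refine (hxi X.xtil t i).trans_lt (lt_of_pow_lt_pow_left₀ 2 hε.le ?_)
      refine lt_of_mul_lt_mul_left ?_ ha.le
      have : e * ε ^ 2 ≤ a * ε ^ 2 := by gcongr; exact min_le_left _ _
      linarith [hUx X t]
    · intro k l
      refine lt_of_pow_lt_pow_left₀ 2 hε.le ?_
      rw [sq_abs]
      refine lt_of_mul_lt_mul_left ?_ ha'.le
      have : e * ε ^ 2 ≤ a' * ε ^ 2 := by gcongr; exact min_le_right _ _
      linarith [hUθ X t i k l]
  · have h1 : IsLinSol (S.Acl Am) (fun t a => S.exo a.1 (d a.1 t) (ref a.1 t) a.2)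
        (stack X.xhat) := by
      intro t ht
      rw [← timeIv_top] at ht ⊢
      exact hasDerivWithinAt_stack_xhat hX ht
    have h2 := (isGAS_of_lyapunov hQ hη hdis).attractive _ _ _ h1 hx
    have h3 : Tendsto (fun t => X.xhat i t - fun k => x t ⟨i, k⟩) atTop (𝓝 0) := by
      refine tendsto_pi_nhds.2 fun k => ?_
      exact tendsto_pi_nhds.1 h2 ⟨i, k⟩
    have h4 := (hconv d ref X hX hR i).add h3
    rw [add_zero] at h4
    refine h4.congr fun t => ?_
    rw [Traj.xtil]
    abel

end AdaptiveLoop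

end RobustMRAC

end

/-! ### Assembly of the main theorem. -/

theorem proposition2 {M : ℕ} {n m q r : Fin M → ℕ} (S : RobustMRAC.LSS M n m q r)
    (Am : ∀ i, Matrix (RobustMRAC.St n q i) (RobustMRAC.St n q i) ℝ)
    (hAm : ∀ i, RobustMRAC.IsHurwitz (Am i))
    (Ξ : Fin M → ℝ)
    (hΞ : ∀ i, ∑ j ∈ S.nbr i, RobustMRAC.lambdaMaxGram (S.Aint i j) ≤ Ξ i ^ 2)
    (hγ : ∀ i, Real.sqrt (((S.nbr i).card : ℝ) * Ξ i ^ 2) < RobustMRAC.gammaDist (Am i)) :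
    ∃ (P : ∀ i, Matrix (RobustMRAC.St n q i) (RobustMRAC.St n q i) ℝ) (ε : Fin M → ℝ),
      (∀ i, (P i).PosDef ∧ 0 < ε i ∧
        (Am i)ᵀ * P i + P i * Am i + ((S.nbr i).card : ℝ) • (P i * P i)
          + (Ξ i ^ 2 + ε i) • (1 : Matrix _ _ ℝ) = 0) ∧
      RobustMRAC.IsGAS (S.Acl Am) ∧
      ∀ (D : RobustMRAC.Design n m q)
        (θ : ∀ i, Matrix (RobustMRAC.St n q i) (Fin (m i)) ℝ),
        (∀ i, S.Abar i - S.Bbar i * D.K i - Am i = S.Bbar i * (θ i)ᵀ) →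
        (∀ i, RobustMRAC.projG (D.θmax i) (D.ε₀ i) (θ i) ≤ 0) →
        RobustMRAC.IsAdaptiveGAS S Am P D θ := by
  have hlocal : ∀ i, ∃ (Q : Matrix (RobustMRAC.St n q i) (RobustMRAC.St n q i) ℝ) (e : ℝ),
      Q.PosDef ∧ 0 < e ∧ (Am i)ᵀ * Q + Q * Am i + ((S.nbr i).card : ℝ) • (Q * Q)
          + (Ξ i ^ 2 + e) • (1 : Matrix _ _ ℝ) = 0 := by
    intro i
    -- The strict gap leaves room, by continuity at 0, for a positive e; this also makes the
    -- constant term positive when Ξ_i = 0.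
    obtain ⟨e, he, he0⟩ : ∃ e, Real.sqrt (((S.nbr i).card : ℝ) * (Ξ i ^ 2 + e)) <
        RobustMRAC.gammaDist (Am i) ∧ 0 < e := by
      have hcont : ContinuousAt (fun e : ℝ => Real.sqrt (((S.nbr i).card : ℝ) * (Ξ i ^ 2 + e)))
          0 := by fun_prop
      have h1 := hcont.eventually_lt_const (by simpa using hγ i)
      exact ((h1.filter_mono nhdsWithin_le_nhds).and
        (self_mem_nhdsWithin (a := (0 : ℝ)) (s := Set.Ioi 0))).exists
    obtain ⟨Q, hQ, hric⟩ := RobustMRAC.exists_posDef_riccati (hAm i) (S.nbr i).card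
      (add_pos_of_nonneg_of_pos (sq_nonneg (Ξ i)) he0) he
    exact ⟨Q, e, hQ, he0, hric⟩
  choose P ε hP using hlocal
  -- The weights serve the analysis only: the update laws use the unweighted local P_i.
  obtain ⟨c, hc, η, hη, hdis⟩ := RobustMRAC.exists_weights_dissipation S hΞ
    (fun i => (hP i).1) (fun i => (hP i).2.1) (fun i => (hP i).2.2)
  refine ⟨P, ε, hP, ?_, fun D θ hθ hg =>
    RobustMRAC.isAdaptiveGAS_of_dissipation hc (fun i => (hP i).1) hη hdis hθ hg⟩
  exact RobustMRAC.isGAS_of_lyapunov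
    (RobustMRAC.posDef_blockDiagonal' fun i => (hP i).1.smul (hc i)) hη hdis
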